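/- Call $\omega:[0,\infty)\to[0,\infty)$ a *pre-weight function* if it is continuous, increasing (i.e. non-decreasing), $\lim_{t\to\infty}\omega(t)=\infty$, and - $(\omega_1)$ $\omega(2t)=O(\omega(t))$ as $t\to\infty$, - $(\omega_2)$ $\log t=o(\omega(t))$ as $t\to\infty$, - $(\omega_3)$ $\varphi_\omega: t\mapsto\omega(e^t)$ is convex on $[0,\infty)$. A *weight function* is a pre-weight function with $\omega|_{[0,1]}=0$. Two pre-weight functions are *equivalent*, $\omega\approx\sigma$, if $\sigma(t)=O(\omega(t))$ and $\omega(t)=O(\sigma(t))$ as $t\to\infty$. For a weight function $\omega$ let $\varphi^*(t)=\sup\{st-\varphi_\omega(s):s\ge0\}$, $t\ge 0$, and for $\rho>0$ let $\Omega^\rho=(\Omega^\rho_k)_{k\in\mathbb N}$ with $\Omega^\rho_k=\frac1{k!}\exp\bigl(\frac1\rho\varphi^*(\rho k)\bigr)$; put $\mathfrak W=\{\Omega^\rho:\rho>0\}$. For open $U\subseteq\mathbb R^m$, $V\subseteq\mathbb R^n$ let $\mathcal E^{\{\omega\}}(U,V)$ be the set of $C^\infty$ mappings $f:U\to V$ such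 that for every compact $K\subseteq U$ there is $\rho>0$ with $$\sup_{x\in K,\ k\in\mathbb N}\|f^{(k)}(x)\|\exp\bigl(-\tfrac1\rho\varphi^*(\rho k)\bigr)<\infty ,$$ where $f^{(k)}$ is the $k$-th Fréchet derivative, with the norm of $k$-linear mappings between Euclidean spaces. $\mathcal E^{\{\omega\}}$ is *stable under composition* if $g\in\mathcal E^{\{\omega\}}(U,V)$ and $f\in\mathcal E^{\{\omega\}}(V,W)$ imply $f\circ g\in\mathcal E^{\{\omega\}}(U,W)$, for all open $U\subseteq\mathbb R^p$, $V\subseteq\mathbb R^q$, $W\subseteq\mathbb R^r$ and all $p,q,r\ge1$. For a positive sequence $M=(M_k)$ put $M^\circ_0=1$ and $M_k^\circ=\max\{M_jM_{\alpha_1}\cdots M_{\alpha_j}:\alpha_i\in\mathbb N_{>0},\ \alpha_1+\dots+\alpha_j=k\}$ for $k\ge1$; write $M\preceq N$ if there are $C,\rho>0$ with $M_k\le C\rho^kN_k$ for all $k$. **Theorem.** Let $\omega$ be a weight function satisfying - $(\omega_4)$ $\omega(t)=O(t)$ as $t\to\infty$. Then the following are equivalent: 1. $\mathcal E^{\{\omega\}}$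 is stable under composition. 2. $\mathfrak W$ satisfies the Roumieu (FdB) condition: for each $\rho>0$ there is $\tau>0$ with $(\Omega^\rho)^\circ\preceq\Omega^\tau$. 3. There is a sub-additive pre-weight function $\tilde\omega$ (i.e. $\tilde\omega(s+t)\le\tilde\omega(s)+\tilde\omega(t)$ for all $s,t\ge0$) with $\omega\approx\tilde\omega$. 4. $\omega$ satisfies $(\omega_7)$: there are $C>0$ and $t_0>0$ with $\omega(\lambda t)\le C\lambda\,\omega(t)$ for all $\lambda\ge1$ and all $t\ge t_0$. No non-quasianalyticity (nor quasianalyticity) is assumed. -/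

import Mathlib

noncomputable section

namespace Ultradiff

/-- Continuous, increasing (in the weak sense) `ω : [0,∞) → [0,∞)` with `ω(t) → ∞` and
`(ω₁)`: `ω(2t) = O(ω(t))`, `(ω₂)`: `log t = o(ω(t))`, `(ω₃)`: `t ↦ ω(eᵗ)` is convex on `[0,∞)`.
These are the requirements on a weight function apart from the normalization `ω = 0` on `[0,1]`.
Only the values of `ω` on `[0,∞)` matter. -/
structure IsPreWeight (ω : ℝ → ℝ) : Prop where
  nonneg : ∀ t, 0 ≤ t → 0 ≤ ω t
  continuousOn : ContinuousOn ω (Set.Ici 0)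
  monotoneOn : MonotoneOn ω (Set.Ici 0)
  tendsto : Filter.Tendsto ω Filter.atTop Filter.atTop
  omega1 : (fun t => ω (2 * t)) =O[Filter.atTop] ω
  omega2 : Real.log =o[Filter.atTop] ω
  omega3 : ConvexOn ℝ (Set.Ici 0) (fun t => ω (Real.exp t))

/-- The set `𝒲` of (normalized) weight functions: in addition `ω = 0` on `[0,1]`. -/
structure IsWeight (ω : ℝ → ℝ) : Prop extends IsPreWeight ω where
  normalized : ∀ t ∈ Set.Icc (0 : ℝ) 1, ω t = 0

/-- `(ω₄)`: `ω(t) = O(t)` as `t → ∞`. -/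
def Omega4 (ω : ℝ → ℝ) : Prop := ω =O[Filter.atTop] (fun t => t)

/-- `(ω₇)`. -/
def Omega7 (ω : ℝ → ℝ) : Prop :=
  ∃ C > 0, ∃ t₀ > 0, ∀ l : ℝ, 1 ≤ l → ∀ t : ℝ, t₀ ≤ t → ω (l * t) ≤ C * l * ω t

/-- Sub-additivity on `[0,∞)`. -/
def IsSubadditive (ω : ℝ → ℝ) : Prop :=
  ∀ s t : ℝ, 0 ≤ s → 0 ≤ t → ω (s + t) ≤ ω s + ω t

/-- `ω ≼ σ`, i.e. `σ(t) = O(ω(t))` as `t → ∞`. -/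
def WeightLE (ω σ : ℝ → ℝ) : Prop := σ =O[Filter.atTop] ω

/-- `ω ≈ σ`. -/
def WeightEquiv (ω σ : ℝ → ℝ) : Prop := WeightLE ω σ ∧ WeightLE σ ω

/-- The Young conjugate `φ*(t) = sup {s t - φ(s) : s ≥ 0}` of `φ(s) = ω(eˢ)`. -/
def youngConj (ω : ℝ → ℝ) (t : ℝ) : ℝ :=
  sSup ((fun s => s * t - ω (Real.exp s)) '' Set.Ici 0)

/-- `Ω^ρ_k = (1 / k!) exp (φ*(ρ k) / ρ)`. -/
def assocSeq (ω : ℝ → ℝ) (ρ : ℝ) (k : ℕ) : ℝ :=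
  1 / (k.factorial : ℝ) * Real.exp (1 / ρ * youngConj ω (ρ * k))

/-- The associated weight matrix `𝔚 = {Ω^ρ : ρ > 0}`. -/
def weightMatrix (ω : ℝ → ℝ) : Set.Ioi (0 : ℝ) → ℕ → ℝ := fun ρ => assocSeq ω ρ

/-- `M°_k = max {M_j M_{α₁} ⋯ M_{αⱼ} : αᵢ ≥ 1, α₁ + ⋯ + αⱼ = k}` and `M°_0 = 1`. -/
def circ (M : ℕ → ℝ) (k : ℕ) : ℝ :=
  if k = 0 then 1
  else (Finset.univ : Finset (Composition k)).sup' Finset.univ_nonempty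
    (fun α => M α.length * ∏ i, M (α.blocksFun i))

/-- `M ≼ N` for sequences: `M_k ≤ C ρ^k N_k` for all `k`, with some `C, ρ > 0`. -/
def SeqLE (M N : ℕ → ℝ) : Prop := ∃ C > 0, ∃ ρ > 0, ∀ k : ℕ, M k ≤ C * ρ ^ k * N k

/-- The Roumieu (FdB) condition for a family of sequences:
for all `λ` there is `μ` with `(M^λ)° ≼ M^μ`. -/
def RoumieuFdB {Λ : Type*} (M : Λ → ℕ → ℝ) : Prop := ∀ l, ∃ m, SeqLE (circ (M l)) (M m)

/-- `ℝⁿ` with its Euclidean norm. -/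
abbrev Euc (n : ℕ) := EuclideanSpace ℝ (Fin n)

/-- The seminorm `‖f‖^ω_{K,ρ} = sup {‖f⁽ᵏ⁾(x)‖ exp (- φ*(ρ k) / ρ) : x ∈ K, k ∈ ℕ}`,
with values in `[0,∞]`. -/
def weightNorm (ω : ℝ → ℝ) {m n : ℕ} (K : Set (Euc m)) (ρ : ℝ) (f : Euc m → Euc n) : ENNReal :=
  ⨆ x ∈ K, ⨆ k : ℕ,
    ENNReal.ofReal (‖iteratedFDeriv ℝ k f x‖ * Real.exp (-(1 / ρ * youngConj ω (ρ * k))))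

/-- `f ∈ ℰ^{ω}(U, V)` (Roumieu type), for open `U` and `V`: `f` maps `U` to `V`, is smooth
on `U`, and for every compact `K ⊆ U` there is `ρ > 0` with `‖f‖^ω_{K,ρ} < ∞`.
Only the values of `f` on `U` matter. -/
def MemRoumieu (ω : ℝ → ℝ) (m n : ℕ) (U : Set (Euc m)) (V : Set (Euc n))
    (f : Euc m → Euc n) : Prop :=
  Set.MapsTo f U V ∧ ContDiffOn ℝ (⊤ : ℕ∞) f U ∧
    ∀ K : Set (Euc m), K ⊆ U → IsCompact K → ∃ ρ > 0, weightNorm ω K ρ f < ⊤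

/-- Stability under composition of a class of mappings between open subsets of
Euclidean spaces of positive dimension. -/
def StableUnderComposition
    (F : ∀ m n : ℕ, Set (Euc m) → Set (Euc n) → (Euc m → Euc n) → Prop) : Prop :=
  ∀ p q r : ℕ, 0 < p → 0 < q → 0 < r →
    ∀ (U : Set (Euc p)) (V : Set (Euc q)) (W : Set (Euc r)),
      IsOpen U → IsOpen V → IsOpen W →
        ∀ (g : Euc p → Euc q) (f : Euc q → Euc r),
          F p q U V g → F q r V W f → F p r U W (f ∘ g)

end Ultradiff

end

/-! Write `M^ρ_k = k! Ω^ρ_k`. Substituting `s = eˣ` in the Young conjugate gives `M^ρ_k = sup {s^k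
exp(-ω(s)/ρ) : s ≥ 1}`, and every estimate is made in this form. The cycle is stability ⇒ `(ω₇)` ⇒
(FdB) ⇒ stability, with sub-additivity tied to `(ω₇)` separately.

Stability ⇒ `(ω₇)`: the lacunary series `G(x) = ∑ 2^{-m} e^{-ω(2^m)} exp(i 2^m x)` is in the class,
and so is `z ↦ 1/(4 - z)`, since `(ω₄)` admits analytic maps. All derivatives of `G` at `0` are
positive up to `i^k`, so nothing cancels in `H = 1/(4 - G) = ∑ G^l / 4^{l+1}`, and one frequency in
one power `G^l` already bounds `|H⁽ⁿ⁾(0)|` from below (`exists_resolvent_lower_bound`). If `H` is in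
the class, choosing the best `n` (`exists_momentSeq_mul_exp_le`) gives `ω(l 2^m) = O(l ω(2^m))`.

`(ω₇)` ⇒ (FdB): a log-convex sequence `N` satisfies `N_j N_{α₁} ⋯ N_{αⱼ} ≤ N_1^j N_k`. Under `(ω₇)`
such an `N` fits between `Ω^ρ` and some `Ω^τ` up to geometric factors (`IsWeight.roumieuFdB`).

(FdB) ⇒ stability: this is Faà di Bruno's formula with the count `sum_partitionWeight_le`; geometric
factors are absorbed by enlarging the index, thanks to `(ω₁)`.

`(ω₇)` ⇔ sub-additivity: `starHull ω` is the sub-additive majorant, and `(ω₇)` says that it is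
`O(ω)`. -/

noncomputable section

namespace Ultradiff

open Filter Set

/-! ### Moment sequences as suprema of `s^k exp(-ω(s)/ρ)`. -/

/-- The moment sequence `exp (φ*(ρ k) / ρ)` of a weight function. -/
def momentSeq (ω : ℝ → ℝ) (ρ : ℝ) (k : ℕ) : ℝ := Real.exp (1 / ρ * youngConj ω (ρ * k))

theorem momentSeq_pos (ω : ℝ → ℝ) (ρ : ℝ) (k : ℕ) : 0 < momentSeq ω ρ k := Real.exp_pos _

theorem assocSeq_eq (ω : ℝ → ℝ) (ρ : ℝ) (k : ℕ) :
    assocSeq ω ρ k = momentSeq ω ρ k / k.factorial := by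
  rw [assocSeq, momentSeq]; ring

theorem assocSeq_pos (ω : ℝ → ℝ) (ρ : ℝ) (k : ℕ) : 0 < assocSeq ω ρ k := by
  rw [assocSeq_eq]
  exact div_pos (momentSeq_pos _ _ _) (by positivity)

theorem exists_support_line {f : ℝ → ℝ} (hf : ConvexOn ℝ (Ici 0) f) {u : ℝ} (hu : 0 < u) :
    ∃ t, ∀ x, 0 ≤ x → f u + t * (x - u) ≤ f x := by
  have hui : u ∈ interior (Ici (0 : ℝ)) := by rwa [interior_Ici]
  refine ⟨derivWithin f (Iio u) u, fun x hx => ?_⟩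
  rcases lt_trichotomy x u with h | rfl | h
  · have := hf.slope_le_leftDeriv_of_mem_interior (mem_Ici.2 hx) hui h
    rw [slope_def_field, div_le_iff₀ (by linarith)] at this
    linarith
  · simp
  · have := (hf.leftDeriv_le_rightDeriv_of_mem_interior hui).trans
      (hf.rightDeriv_le_slope_of_mem_interior hui (mem_Ici.2 hx) h)
    rw [slope_def_field, le_div_iff₀ (by linarith)] at this
    linarith

namespace IsPreWeight

variable {ω : ℝ → ℝ}

/-- By `(ω₂)`, `ω(eˢ)` eventually exceeds `(|t| + 1) s`, so only a bounded range of `s` can give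
positive values. Without boundedness `sSup` would take its default value `0`. -/
theorem bddAbove_youngConj (hω : IsPreWeight ω) (t : ℝ) :
    BddAbove ((fun s => s * t - ω (Real.exp s)) '' Ici 0) := by
  have h2 := hω.omega2.def (show 0 < 1 / (|t| + 1) by positivity)
  obtain ⟨S, hS⟩ := eventually_atTop.1 h2
  refine ⟨|t| * max 0 (Real.log (max S 1)), ?_⟩
  rintro _ ⟨s, hs, rfl⟩
  have hs0 : 0 ≤ s := hs
  have hω0 : 0 ≤ ω (Real.exp s) := hω.nonneg _ (Real.exp_pos _).le
  have hst : s * t ≤ |t| * s := by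
    rw [mul_comm]; exact mul_le_mul_of_nonneg_right (le_abs_self t) hs0
  have hm : 0 ≤ |t| * max 0 (Real.log (max S 1)) := by positivity
  rcases le_total S (Real.exp s) with h | h
  · have := hS _ h
    rw [Real.log_exp, Real.norm_of_nonneg hs0, Real.norm_of_nonneg hω0, one_div_mul_eq_div,
      le_div_iff₀ (by positivity)] at this
    dsimp only
    nlinarith
  · have : s ≤ Real.log (max S 1) := by
      rw [Real.le_log_iff_exp_le (by positivity)]
      exact h.trans (le_max_left _ _)
    have : |t| * s ≤ |t| * max 0 (Real.log (max S 1)) :=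
      mul_le_mul_of_nonneg_left (this.trans (le_max_right _ _)) (abs_nonneg t)
    dsimp only
    linarith

/-- Together with `momentSeq_le` this identifies `momentSeq ω ρ k` as the supremum over `s ≥ 1`;
later arguments use these two bounds instead of the Young conjugate. -/
theorem pow_mul_exp_le_momentSeq (hω : IsPreWeight ω) {ρ s : ℝ} (hρ : 0 < ρ) (hs : 1 ≤ s) (k : ℕ) :
    s ^ k * Real.exp (-(ω s / ρ)) ≤ momentSeq ω ρ k := by
  have hs0 : 0 < s := by linarith
  have h := le_csSup (hω.bddAbove_youngConj (ρ * k)) (mem_image_of_mem _ (Real.log_nonneg hs))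
  rw [← youngConj] at h
  simp only [Real.exp_log hs0] at h
  have e : s ^ k = Real.exp (k * Real.log s) := by
    rw [Real.exp_nat_mul, Real.exp_log hs0]
  rw [e, ← Real.exp_add, momentSeq, Real.exp_le_exp, one_div_mul_eq_div, le_div_iff₀ hρ]
  have : (k * Real.log s + -(ω s / ρ)) * ρ = Real.log s * (ρ * k) - ω s := by
    field_simp
    ring
  rwa [this]

theorem momentSeq_le {ρ B : ℝ} (hρ : 0 < ρ) (k : ℕ)
    (h : ∀ s, 1 ≤ s → s ^ k * Real.exp (-(ω s / ρ)) ≤ B) : momentSeq ω ρ k ≤ B := by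
  have hB : 0 < B := lt_of_lt_of_le (by positivity) (h 1 le_rfl)
  have : youngConj ω (ρ * k) ≤ ρ * Real.log B := by
    refine csSup_le (nonempty_Ici.image _) ?_
    rintro _ ⟨x, hx, rfl⟩
    have := h (Real.exp x) (Real.one_le_exp hx)
    rw [← Real.exp_nat_mul, ← Real.exp_add, ← Real.le_log_iff_exp_le hB] at this
    have := mul_le_mul_of_nonneg_left this hρ.le
    have e : ρ * (k * x + -(ω (Real.exp x) / ρ)) = x * (ρ * k) - ω (Real.exp x) := by
      field_simp
      ring
    rwa [e] at this
  rw [momentSeq, ← Real.le_log_iff_exp_le hB, one_div_mul_eq_div, div_le_iff₀ hρ]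
  linarith

theorem momentSeq_mono (hω : IsPreWeight ω) {ρ τ : ℝ} (hρ : 0 < ρ) (h : ρ ≤ τ) (k : ℕ) :
    momentSeq ω ρ k ≤ momentSeq ω τ k := by
  refine momentSeq_le hρ k fun s hs => ?_
  refine le_trans ?_ (hω.pow_mul_exp_le_momentSeq (hρ.trans_le h) hs k)
  have := hω.nonneg s (by linarith)
  gcongr

/-- Iteration of `(ω₁)`. -/
theorem exists_dilation_bound (hω : IsPreWeight ω) {h : ℝ} (h0 : 0 ≤ h) :
    ∃ L ≥ 1, ∀ s, 0 ≤ s → ω (h * s) ≤ L * ω s + L := by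
  have base : ∃ L ≥ (1 : ℝ), ∀ s, 0 ≤ s → ω (2 * s) ≤ L * ω s + L := by
    obtain ⟨C, hC⟩ := hω.omega1.bound
    obtain ⟨T, hT⟩ := eventually_atTop.1 hC
    refine ⟨max 1 (max C (ω (2 * max T 0))), le_max_left _ _, fun s hs => ?_⟩
    have hs' := hω.nonneg s hs
    set L := max 1 (max C (ω (2 * max T 0))) with hL
    have h1 : 1 ≤ L := le_max_left _ _
    rcases le_total T s with h | h
    · have := hT s h
      rw [Real.norm_of_nonneg hs', Real.norm_of_nonneg (hω.nonneg _ (by linarith))] at this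
      have : C * ω s ≤ L * ω s :=
        mul_le_mul_of_nonneg_right ((le_max_left _ _).trans (le_max_right _ _)) hs'
      linarith
    · have h3 : ω (2 * s) ≤ ω (2 * max T 0) := by
        refine hω.monotoneOn (mem_Ici.2 (by linarith)) (mem_Ici.2 (by positivity)) ?_
        have := h.trans (le_max_left T 0)
        linarith
      have h4 : ω (2 * max T 0) ≤ L := (le_max_right _ _).trans (le_max_right _ _)
      nlinarith
  obtain ⟨L, hL, hb⟩ := base
  have iter : ∀ n : ℕ, ∃ L ≥ (1 : ℝ), ∀ s, 0 ≤ s → ω (2 ^ n * s) ≤ L * ω s + L := by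
    intro n
    induction n with
    | zero => exact ⟨1, le_rfl, fun s _ => by simp⟩
    | succ n ih =>
      obtain ⟨K, hK, hk⟩ := ih
      refine ⟨L * K + L, by nlinarith, fun s hs => ?_⟩
      have h1 := hb (2 ^ n * s) (by positivity)
      have h2 := hk s hs
      have h3 := hω.nonneg s hs
      have e : (2 : ℝ) ^ (n + 1) * s = 2 * (2 ^ n * s) := by ring
      rw [e]
      nlinarith
  obtain ⟨n, hn⟩ := pow_unbounded_of_one_lt h (one_lt_two : (1 : ℝ) < 2)
  obtain ⟨K, hK, hk⟩ := iter n
  refine ⟨K, hK, fun s hs => le_trans ?_ (hk s hs)⟩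
  exact hω.monotoneOn (mem_Ici.2 (by positivity)) (mem_Ici.2 (by positivity))
    (mul_le_mul_of_nonneg_right hn.le hs)

/-- Geometric factors are absorbed by the index of the weight matrix. -/
theorem exists_pow_mul_momentSeq_le (hω : IsPreWeight ω) {h τ : ℝ} (h0 : 0 ≤ h) (hτ : 0 < τ) :
    ∃ τ' > 0, ∃ D > 0, ∀ k : ℕ, h ^ k * momentSeq ω τ k ≤ D * momentSeq ω τ' k := by
  -- Replace `s` by `h s` in the supremum: `ω(h s) ≤ L ω(s) + L` turns the index `τ` into `L τ`. The
  -- maximum with `1` keeps the dilated argument in `[1,∞)`.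
  obtain ⟨L, hL, hb⟩ := hω.exists_dilation_bound (h := max h 1) (by positivity)
  have hL0 : 0 < L := by linarith
  refine ⟨L * τ, by positivity, Real.exp (1 / τ), Real.exp_pos _, fun k => ?_⟩
  have h1 : momentSeq ω τ k ≤
      Real.exp (1 / τ) * momentSeq ω (L * τ) k / (max h 1) ^ k := by
    refine momentSeq_le hτ k fun s hs => ?_
    rw [le_div_iff₀ (by positivity)]
    have hs' : 1 ≤ max h 1 * s := by
      have := le_max_right h 1
      nlinarith
    have := hω.pow_mul_exp_le_momentSeq (ρ := L * τ) (by positivity) hs' k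
    calc s ^ k * Real.exp (-(ω s / τ)) * max h 1 ^ k
        = (max h 1 * s) ^ k * Real.exp (-(ω s / τ)) := by rw [mul_pow]; ring
      _ ≤ (max h 1 * s) ^ k *
          (Real.exp (1 / τ) * Real.exp (-(ω (max h 1 * s) / (L * τ)))) := by
        rw [← Real.exp_add]
        gcongr
        have := hb s (by linarith)
        rw [neg_le_iff_add_nonneg]
        have e : 1 / τ + -(ω (max h 1 * s) / (L * τ)) + ω s / τ =
            (L * ω s + L - ω (max h 1 * s)) / (L * τ) := by
          field_simp
          ring
        rw [e]
        exact div_nonneg (by linarith) (by positivity)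
      _ = Real.exp (1 / τ) *
          ((max h 1 * s) ^ k * Real.exp (-(ω (max h 1 * s) / (L * τ)))) := by ring
      _ ≤ _ := by gcongr
  rw [le_div_iff₀ (by positivity)] at h1
  refine le_trans ?_ h1
  rw [mul_comm]
  have := (momentSeq_pos ω τ k).le
  gcongr
  exact le_max_left _ _

end IsPreWeight

namespace IsWeight

variable {ω : ℝ → ℝ}

theorem apply_one (hω : IsWeight ω) : ω 1 = 0 := hω.normalized 1 (by simp)

theorem one_le_momentSeq (hω : IsWeight ω) {ρ : ℝ} (hρ : 0 < ρ) (k : ℕ) :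
    1 ≤ momentSeq ω ρ k := by
  simpa [hω.apply_one] using hω.toIsPreWeight.pow_mul_exp_le_momentSeq hρ le_rfl k

theorem momentSeq_zero_le (hω : IsWeight ω) {ρ : ℝ} (hρ : 0 < ρ) : momentSeq ω ρ 0 ≤ 1 := by
  refine IsPreWeight.momentSeq_le hρ 0 fun s hs => ?_
  have := hω.nonneg s (by linarith)
  simp only [pow_zero, one_mul, Real.exp_le_one_iff]
  have : 0 ≤ ω s / ρ := by positivity
  linarith

/-- The moment sequence determines the weight, up to one power of the argument. -/
theorem exists_momentSeq_mul_exp_le (hω : IsWeight ω) {τ s : ℝ} (hτ : 0 < τ) (hs : 1 ≤ s) :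
    ∃ n : ℕ, momentSeq ω τ n * Real.exp (ω s / τ) ≤ s ^ (n + 1) := by
  rcases hs.eq_or_lt with rfl | hs1
  · exact ⟨0, by simpa [hω.apply_one] using hω.momentSeq_zero_le hτ⟩
  have hs0 : 0 < s := by linarith
  have hu : 0 < Real.log s := Real.log_pos hs1
  obtain ⟨t, ht⟩ := exists_support_line hω.omega3 hu
  simp only [Real.exp_log hs0] at ht
  have ht0 : 0 ≤ t := by
    have h1 := ht 0 le_rfl
    rw [Real.exp_zero, hω.apply_one] at h1
    have := hω.nonneg s hs0.le
    by_contra! hneg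
    nlinarith
  -- With the real exponent `t / τ`, `v ↦ v^(t/τ) exp(-ω(v)/τ)` is largest at `v = s`, because `t`
  -- is a supporting slope at `log s`. Rounding the exponent down costs at most one factor `s`.
  refine ⟨⌊t / τ⌋₊, ?_⟩
  set n := ⌊t / τ⌋₊
  have hn : (n : ℝ) ≤ t / τ := Nat.floor_le (by positivity)
  have hn' : t / τ < n + 1 := Nat.lt_floor_add_one _
  rw [← le_div_iff₀ (Real.exp_pos _)]
  refine IsPreWeight.momentSeq_le hτ n fun v hv => ?_
  have hv0 : 0 < v := by linarith
  have hx := Real.log_nonneg hv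
  have h1 := ht _ hx
  rw [Real.exp_log hv0] at h1
  have h2 : ω s / τ + t / τ * (Real.log v - Real.log s) ≤ ω v / τ := by
    have := div_le_div_of_nonneg_right h1 hτ.le
    calc _ = (ω s + t * (Real.log v - Real.log s)) / τ := by ring
      _ ≤ _ := this
  rw [le_div_iff₀ (Real.exp_pos _), mul_assoc, ← Real.exp_add]
  have e1 : v ^ n = Real.exp (n * Real.log v) := by rw [Real.exp_nat_mul, Real.exp_log hv0]
  have e2 : s ^ (n + 1) = Real.exp ((n + 1 : ℕ) * Real.log s) := by
    rw [Real.exp_nat_mul, Real.exp_log hs0]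
  rw [e1, e2, ← Real.exp_add, Real.exp_le_exp]
  push_cast
  nlinarith [mul_nonneg (sub_nonneg.2 hn) hx, mul_nonneg (sub_nonneg.2 hn'.le) hu.le]

theorem exists_linear_bound (hω : IsWeight ω) (h4 : Omega4 ω) :
    ∃ A > 0, ∀ s, 0 ≤ s → ω s ≤ A * s := by
  obtain ⟨C, hC⟩ := h4.bound
  obtain ⟨T, hT⟩ := eventually_atTop.1 hC
  refine ⟨max 1 (max C (ω (max T 0))), by positivity, fun s hs => ?_⟩
  set A := max 1 (max C (ω (max T 0)))
  rcases le_total s 1 with h1 | h1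
  · rw [hω.normalized s ⟨hs, h1⟩]
    positivity
  rcases le_total T s with h | h
  · have := hT s h
    rw [Real.norm_of_nonneg (hω.nonneg s hs), Real.norm_of_nonneg hs] at this
    refine this.trans (mul_le_mul_of_nonneg_right ?_ hs)
    exact (le_max_left _ _).trans (le_max_right _ _)
  · have h3 : ω s ≤ ω (max T 0) :=
      hω.monotoneOn (mem_Ici.2 hs) (mem_Ici.2 (by positivity)) (h.trans (le_max_left _ _))
    have h4 : ω (max T 0) ≤ A := (le_max_right _ _).trans (le_max_right _ _)
    have h5 : 0 < A := by positivity
    nlinarith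

/-- Under `(ω₄)` the class contains the real analytic functions. -/
theorem exists_factorial_le (hω : IsWeight ω) (h4 : Omega4 ω) {h : ℝ} (h0 : 0 ≤ h) :
    ∃ τ > 0, ∃ D > 0, ∀ k : ℕ, h ^ k * k.factorial ≤ D * momentSeq ω τ k := by
  obtain ⟨A, hA, hb⟩ := hω.exists_linear_bound h4
  -- Testing the supremum at `s = k` gives `k! ≤ k^k ≤ e^{A k} M¹_k`, whence the factor `exp A`.
  obtain ⟨τ, hτ, D, hD, hk⟩ := hω.toIsPreWeight.exists_pow_mul_momentSeq_le
    (h := h * Real.exp A) (by positivity) one_pos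
  refine ⟨τ, hτ, D, hD, fun k => le_trans ?_ (hk k)⟩
  rw [mul_pow, mul_assoc]
  refine mul_le_mul_of_nonneg_left ?_ (by positivity)
  rcases Nat.eq_zero_or_pos k with rfl | hk0
  · simpa using hω.one_le_momentSeq one_pos 0
  have hk1 : (1 : ℝ) ≤ k := by exact_mod_cast hk0
  have h1 := hω.toIsPreWeight.pow_mul_exp_le_momentSeq one_pos hk1 k
  have h2 : Real.exp (-(A * k)) ≤ Real.exp (-(ω k / 1)) := by
    rw [Real.exp_le_exp, div_one]
    linarith [hb k (by positivity)]
  have h3 : (k.factorial : ℝ) ≤ (k : ℝ) ^ k := by exact_mod_cast Nat.factorial_le_pow k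
  rw [← Real.exp_nat_mul]
  calc (k.factorial : ℝ) ≤ (k : ℝ) ^ k := h3
    _ = Real.exp (k * A) * ((k : ℝ) ^ k * Real.exp (-(A * k))) := by
      rw [mul_left_comm, ← Real.exp_add]
      ring_nf
      simp
    _ ≤ Real.exp (k * A) * momentSeq ω 1 k := by
      gcongr
      exact (mul_le_mul_of_nonneg_left h2 (by positivity)).trans h1

end IsWeight

/-! ### The sub-additive majorant and its relation to `(ω₇)`. -/

/-- The smallest function above `ω` whose quotient by the identity is non-increasing. -/
def starHull (ω : ℝ → ℝ) (t : ℝ) : ℝ := ⨆ l : Ici (1 : ℝ), ω (l * t) / l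

theorem starHull_le {ω : ℝ → ℝ} {t B : ℝ} (h : ∀ l, 1 ≤ l → ω (l * t) / l ≤ B) : starHull ω t ≤ B := by
  have : Nonempty (Ici (1 : ℝ)) := ⟨⟨1, self_mem_Ici⟩⟩
  exact ciSup_le fun l => h l l.2

namespace IsWeight

variable {ω : ℝ → ℝ}

/-- `(ω₄)` makes the hull finite; an unbounded real supremum would be `0`. -/
theorem bddAbove_starHull (hω : IsWeight ω) (h4 : Omega4 ω) {t : ℝ} (ht : 0 ≤ t) :
    BddAbove (range fun l : Ici (1 : ℝ) => ω (l * t) / l) := by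
  obtain ⟨A, hA, hb⟩ := hω.exists_linear_bound h4
  refine ⟨A * t, ?_⟩
  rintro _ ⟨⟨l, hl⟩, rfl⟩
  have hl0 : (0 : ℝ) < l := lt_of_lt_of_le one_pos hl
  dsimp only
  rw [div_le_iff₀ hl0]
  linarith [hb (l * t) (by positivity)]

theorem div_le_starHull (hω : IsWeight ω) (h4 : Omega4 ω) {t l : ℝ} (ht : 0 ≤ t) (hl : 1 ≤ l) :
    ω (l * t) / l ≤ starHull ω t :=
  le_ciSup (hω.bddAbove_starHull h4 ht) ⟨l, hl⟩

theorem le_starHull (hω : IsWeight ω) (h4 : Omega4 ω) {t : ℝ} (ht : 0 ≤ t) :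
    ω t ≤ starHull ω t := by
  simpa using hω.div_le_starHull h4 ht le_rfl

theorem starHull_mono (hω : IsWeight ω) (h4 : Omega4 ω) {s t : ℝ} (hs : 0 ≤ s) (hst : s ≤ t) :
    starHull ω s ≤ starHull ω t := by
  refine starHull_le fun l hl => le_trans ?_ (hω.div_le_starHull h4 (hs.trans hst) hl)
  have hl0 : 0 < l := by linarith
  have h0 : 0 ≤ t := hs.trans hst
  gcongr
  exact hω.monotoneOn (mem_Ici.2 (by positivity)) (mem_Ici.2 (by positivity)) (by gcongr)

theorem starHull_mul_le (hω : IsWeight ω) (h4 : Omega4 ω) {t r : ℝ} (ht : 0 ≤ t) (hr : 1 ≤ r) :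
    starHull ω (r * t) ≤ r * starHull ω t := by
  refine starHull_le fun l hl => ?_
  have h := hω.div_le_starHull h4 ht (l := l * r) (by nlinarith)
  have hl0 : 0 < l := by linarith
  have hr0 : 0 < r := by linarith
  rw [div_le_iff₀ (by positivity)] at h ⊢
  rw [← mul_assoc]
  linarith

/-- A function whose quotient by the identity is non-increasing is sub-additive: the shares
`s/(s+t)` and `t/(s+t)` of its value at `s + t` are at most its values at `s` and `t`. -/
theorem starHull_subadditive (hω : IsWeight ω) (h4 : Omega4 ω) : IsSubadditive (starHull ω) := by
  intro s t hs ht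
  have key : ∀ s t : ℝ, 0 ≤ s → 0 ≤ t → 0 < s + t →
      s / (s + t) * starHull ω (s + t) ≤ starHull ω s := by
    intro s t hs ht h
    rcases hs.eq_or_lt with rfl | hs0
    · simp only [zero_div, zero_mul]
      exact (hω.nonneg 0 le_rfl).trans (hω.le_starHull h4 le_rfl)
    · have := hω.starHull_mul_le h4 hs (r := (s + t) / s) (by rw [le_div_iff₀ hs0]; linarith)
      rw [div_mul_cancel₀ _ hs0.ne'] at this
      calc s / (s + t) * starHull ω (s + t)
          ≤ s / (s + t) * ((s + t) / s * starHull ω s) := by gcongr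
        _ = starHull ω s := by field_simp
  rcases (add_nonneg hs ht).eq_or_lt with h | h
  · obtain rfl : s = 0 := by linarith
    obtain rfl : t = 0 := by linarith
    have := (hω.nonneg 0 le_rfl).trans (hω.le_starHull h4 le_rfl)
    simpa using this
  · have h1 := key s t hs ht h
    have h2 := key t s ht hs (by linarith)
    rw [add_comm t s] at h2
    calc starHull ω (s + t)
        = s / (s + t) * starHull ω (s + t) + t / (s + t) * starHull ω (s + t) := by
          field_simp
      _ ≤ _ := add_le_add h1 h2

theorem starHull_isPreWeight (hω : IsWeight ω) (h4 : Omega4 ω) : IsPreWeight (starHull ω) := by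
  have hnn : ∀ t, 0 ≤ t → 0 ≤ starHull ω t := fun t ht =>
    (hω.nonneg t ht).trans (hω.le_starHull h4 ht)
  have hO : ω =O[atTop] starHull ω := by
    refine Asymptotics.IsBigO.of_bound 1 ?_
    filter_upwards [eventually_ge_atTop 0] with t ht
    rw [Real.norm_of_nonneg (hω.nonneg t ht), Real.norm_of_nonneg (hnn t ht), one_mul]
    exact hω.le_starHull h4 ht
  refine ⟨hnn, ?_, fun s hs t _ hst => hω.starHull_mono h4 hs hst, ?_, ?_, ?_, ?_⟩
  -- Continuity: sub-additivity, monotonicity and the bound by `A t` make the hull `A`-Lipschitz.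
  · obtain ⟨A, hA, hb⟩ := hω.exists_linear_bound h4
    have hlin : ∀ t, 0 ≤ t → starHull ω t ≤ A * t := fun t ht => starHull_le fun l hl => by
      have hl0 : 0 < l := by linarith
      rw [div_le_iff₀ hl0]
      linarith [hb (l * t) (by positivity)]
    have hlip : ∀ x y, 0 ≤ x → x ≤ y → starHull ω y ≤ starHull ω x + A * (y - x) := by
      intro x y hx hxy
      have h1 := hω.starHull_subadditive h4 x (y - x) hx (by linarith)
      have h2 := hlin (y - x) (by linarith)
      rw [add_sub_cancel] at h1
      linarith
    refine (LipschitzOnWith.of_le_add_mul (K := A.toNNReal) (f := starHull ω) ?_).continuousOn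
    intro x hx y hy
    rw [Real.coe_toNNReal _ hA.le, Real.dist_eq]
    rcases le_total x y with h | h
    · have := hω.starHull_mono h4 hx h
      have : 0 ≤ A * |x - y| := by positivity
      linarith
    · rw [abs_of_nonneg (by linarith)]
      exact hlip y x hy h
  · exact tendsto_atTop_mono' _ (by
      filter_upwards [eventually_ge_atTop 0] with t ht using hω.le_starHull h4 ht) hω.tendsto
  · refine Asymptotics.IsBigO.of_bound 2 ?_
    filter_upwards [eventually_ge_atTop 0] with t ht
    rw [Real.norm_of_nonneg (hnn t ht), Real.norm_of_nonneg (hnn _ (by linarith))]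
    exact hω.starHull_mul_le h4 ht one_le_two
  · exact hω.omega2.trans_isBigO hO
  · refine ⟨convex_Ici 0, fun x hx y hy a b ha hb hab => ?_⟩
    refine starHull_le fun l hl => ?_
    have hl0 : 0 < l := by linarith
    -- Dilation by `l` becomes translation by `log l ≥ 0`, which preserves both convexity and the
    -- half-line; a supremum of convex functions is convex.
    have e : ∀ z, l * Real.exp z = Real.exp (z + Real.log l) := fun z => by
      rw [Real.exp_add, Real.exp_log hl0, mul_comm]
    have hlog := Real.log_nonneg hl
    have hc := hω.omega3.2 (x := x + Real.log l) (y := y + Real.log l)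
      (mem_Ici.2 (add_nonneg hx hlog)) (mem_Ici.2 (add_nonneg hy hlog)) ha hb hab
    have h1 := hω.div_le_starHull h4 (Real.exp_pos x).le hl
    have h2 := hω.div_le_starHull h4 (Real.exp_pos y).le hl
    simp only [smul_eq_mul] at hc ⊢
    have e2 : a * (x + Real.log l) + b * (y + Real.log l) = a * x + b * y + Real.log l := by
      linear_combination Real.log l * hab
    rw [e2] at hc
    rw [e] at h1 h2 ⊢
    calc ω (Real.exp (a * x + b * y + Real.log l)) / l
        ≤ (a * ω (Real.exp (x + Real.log l)) + b * ω (Real.exp (y + Real.log l))) / l := by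
          gcongr
      _ = a * (ω (Real.exp (x + Real.log l)) / l) + b * (ω (Real.exp (y + Real.log l)) / l) := by
          ring
      _ ≤ _ := by gcongr

theorem starHull_equiv (hω : IsWeight ω) (h4 : Omega4 ω) (h7 : Omega7 ω) :
    WeightEquiv ω (starHull ω) := by
  have hnn : ∀ t, 0 ≤ t → 0 ≤ starHull ω t := fun t ht =>
    (hω.nonneg t ht).trans (hω.le_starHull h4 ht)
  constructor
  · obtain ⟨C, hC, t₀, ht₀, h⟩ := h7
    refine Asymptotics.IsBigO.of_bound C ?_
    filter_upwards [eventually_ge_atTop t₀] with t ht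
    have ht0 : 0 ≤ t := by linarith
    rw [Real.norm_of_nonneg (hω.nonneg t ht0), Real.norm_of_nonneg (hnn t ht0)]
    refine starHull_le fun l hl => ?_
    rw [div_le_iff₀ (by linarith)]
    linarith [h l hl t ht]
  · refine Asymptotics.IsBigO.of_bound 1 ?_
    filter_upwards [eventually_ge_atTop 0] with t ht
    rw [Real.norm_of_nonneg (hω.nonneg t ht), Real.norm_of_nonneg (hnn t ht), one_mul]
    exact hω.le_starHull h4 ht

end IsWeight

theorem IsSubadditive.nat_mul_le {σ : ℝ → ℝ} (hs : IsSubadditive σ) {t : ℝ} (ht : 0 ≤ t) :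
    ∀ n : ℕ, 1 ≤ n → σ (n * t) ≤ n * σ t := by
  intro n hn
  induction n, hn using Nat.le_induction with
  | base => simp
  | succ n hn ih =>
    have := hs (n * t) t (by positivity) ht
    push_cast
    rw [add_mul, one_mul]
    linarith

/-- Round `l` up to an integer, at most `2 l`, and iterate sub-additivity; the two equivalence
constants account for the rest. -/
theorem Omega7.of_subadditive {ω σ : ℝ → ℝ} (hω : IsPreWeight ω) (hσ : IsPreWeight σ)
    (hs : IsSubadditive σ) (he : WeightEquiv ω σ) : Omega7 ω := by
  obtain ⟨A, hA, hA'⟩ := he.1.exists_pos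
  obtain ⟨B, hB, hB'⟩ := he.2.exists_pos
  obtain ⟨T, hT⟩ := eventually_atTop.1 (hA'.bound.and hB'.bound)
  refine ⟨B * 2 * A, by positivity, max T 1, by positivity, fun l hl t ht => ?_⟩
  have ht1 : 1 ≤ t := (le_max_right _ _).trans ht
  have htT : T ≤ t := (le_max_left _ _).trans ht
  have ht0 : 0 ≤ t := by linarith
  have hlt : t ≤ l * t := by nlinarith
  have h1 := (hT t htT).1
  have h2 := (hT (l * t) (htT.trans hlt)).2
  have hlt0 : 0 ≤ l * t := by linarith
  rw [Real.norm_of_nonneg (hω.nonneg t ht0), Real.norm_of_nonneg (hσ.nonneg t ht0)] at h1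
  rw [Real.norm_of_nonneg (hω.nonneg _ hlt0), Real.norm_of_nonneg (hσ.nonneg _ hlt0)] at h2
  have hceil : (⌈l⌉₊ : ℝ) ≤ 2 * l := by linarith [Nat.ceil_lt_add_one (by linarith : 0 ≤ l)]
  have h3 : σ (l * t) ≤ 2 * l * σ t := by
    refine (hσ.monotoneOn (mem_Ici.2 hlt0) (mem_Ici.2 (by positivity))
      (mul_le_mul_of_nonneg_right (Nat.le_ceil l) ht0)).trans ?_
    refine (hs.nat_mul_le ht0 _ (Nat.one_le_ceil_iff.2 (by linarith))).trans ?_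
    exact mul_le_mul_of_nonneg_right hceil (hσ.nonneg t ht0)
  calc ω (l * t) ≤ B * σ (l * t) := h2
    _ ≤ B * (2 * l * (A * ω t)) := by
      gcongr
      exact h3.trans (mul_le_mul_of_nonneg_left h1 (by linarith))
    _ = _ := by ring

/-! ### Log-convex sequences and the (FdB) condition. -/

section LogConvex

variable {N : ℕ → ℝ}

theorem ratio_mul_le (hpos : ∀ k, 0 < N k) (hlc : ∀ k, N (k + 1) ^ 2 ≤ N k * N (k + 2))
    {p q : ℕ} (h : p ≤ q) : N (p + 1) * N q ≤ N p * N (q + 1) := by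
  have hm : Monotone fun k => N (k + 1) / N k := by
    refine monotone_nat_of_le_succ fun k => ?_
    rw [div_le_div_iff₀ (hpos _) (hpos _)]
    nlinarith [hlc k]
  have := hm h
  dsimp only at this
  rw [div_le_div_iff₀ (hpos _) (hpos _)] at this
  linarith

theorem mul_le_one_mul_add (hpos : ∀ k, 0 < N k) (hlc : ∀ k, N (k + 1) ^ 2 ≤ N k * N (k + 2))
    (k : ℕ) {a : ℕ} (ha : 1 ≤ a) : N (k + 1) * N a ≤ N 1 * N (k + a) := by
  induction a, ha using Nat.le_induction with
  | base => rw [mul_comm]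
  | succ a ha ih =>
    have h := ratio_mul_le hpos hlc (show a ≤ k + a by omega)
    refine le_of_mul_le_mul_right ?_ (hpos a)
    calc N (k + 1) * N (a + 1) * N a = N (a + 1) * (N (k + 1) * N a) := by ring
      _ ≤ N (a + 1) * (N 1 * N (k + a)) := mul_le_mul_of_nonneg_left ih (hpos _).le
      _ = N 1 * (N (a + 1) * N (k + a)) := by ring
      _ ≤ N 1 * (N a * N (k + a + 1)) := mul_le_mul_of_nonneg_left h (hpos _).le
      _ = _ := by rw [add_assoc]; ring

/-- Induct on blocks. Since blocks are positive, the length is at most the sum, so monotone ratios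
move the increment of the index from the length to the sum; `mul_le_one_mul_add` then merges the new
block at the cost of one factor `N 1`. -/
theorem length_mul_prod_le (hpos : ∀ k, 0 < N k) (hlc : ∀ k, N (k + 1) ^ 2 ≤ N k * N (k + 2))
    (l : List ℕ) (hl : ∀ i ∈ l, 0 < i) :
    N l.length * (l.map N).prod ≤ N 1 ^ l.length * N l.sum := by
  induction l with
  | nil => simp
  | cons a l ih =>
    have hl' : ∀ i ∈ l, 0 < i := fun i hi => hl i (List.mem_cons_of_mem _ hi)
    have ha : 1 ≤ a := hl a List.mem_cons_self
    have hjk : l.length ≤ l.sum := List.length_le_sum_of_one_le l hl'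
    have h1 := ratio_mul_le hpos hlc hjk
    have h2 := mul_le_one_mul_add hpos hlc l.sum ha
    have h3 := ih hl'
    simp only [List.length_cons, List.map_cons, List.prod_cons, List.sum_cons]
    rw [add_comm a]
    have p1 := (hpos (l.length + 1)).le
    have p2 := (hpos a).le
    have p3 := (hpos 1).le
    have p4 := (hpos l.length).le
    refine le_of_mul_le_mul_right ?_ (hpos l.length)
    calc N (l.length + 1) * (N a * (l.map N).prod) * N l.length
        = N (l.length + 1) * N a * (N l.length * (l.map N).prod) := by ring
      _ ≤ N (l.length + 1) * N a * (N 1 ^ l.length * N l.sum) := by gcongr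
      _ = N 1 ^ l.length * N a * (N (l.length + 1) * N l.sum) := by ring
      _ ≤ N 1 ^ l.length * N a * (N l.length * N (l.sum + 1)) := by gcongr
      _ = N 1 ^ l.length * N l.length * (N (l.sum + 1) * N a) := by ring
      _ ≤ N 1 ^ l.length * N l.length * (N 1 * N (l.sum + a)) := by gcongr
      _ = _ := by ring

theorem composition_length_mul_prod_le (hpos : ∀ k, 0 < N k)
    (hlc : ∀ k, N (k + 1) ^ 2 ≤ N k * N (k + 2)) {k : ℕ} (α : Composition k) :
    N α.length * ∏ i, N (α.blocksFun i) ≤ N 1 ^ α.length * N k := by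
  have h := length_mul_prod_le hpos hlc α.blocks fun i hi => α.blocks_pos hi
  rw [α.blocks_sum] at h
  have e : (α.blocks.map N).prod = ∏ i, N (α.blocksFun i) := by
    rw [← α.ofFn_blocksFun, List.map_ofFn, List.prod_ofFn]
    rfl
  rwa [e] at h

/-- Suprema of exponential families are log-convex. -/
theorem iSup_mul_pow_logConvex {ι : Type*} [Nonempty ι] {a b : ι → ℝ} (ha : ∀ i, 0 < a i)
    (hb : ∀ i, 0 < b i) (hbdd : ∀ k : ℕ, BddAbove (range fun i => b i * a i ^ k)) (k : ℕ) :
    (⨆ i, b i * a i ^ (k + 1)) ^ 2 ≤ (⨆ i, b i * a i ^ k) * ⨆ i, b i * a i ^ (k + 2) := by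
  have h0 : ∀ n : ℕ, 0 ≤ ⨆ i, b i * a i ^ n := fun n =>
    Real.iSup_nonneg fun i => by have := ha i; have := hb i; positivity
  rw [← Real.le_sqrt (h0 _) (mul_nonneg (h0 _) (h0 _))]
  refine ciSup_le fun i => ?_
  have hai := ha i
  have hbi := hb i
  rw [Real.le_sqrt (by positivity) (mul_nonneg (h0 _) (h0 _))]
  calc (b i * a i ^ (k + 1)) ^ 2 = (b i * a i ^ k) * (b i * a i ^ (k + 2)) := by ring
    _ ≤ _ := mul_le_mul (le_ciSup (hbdd k) i) (le_ciSup (hbdd (k + 2)) i) (by positivity) (h0 _)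

end LogConvex

/-- A sequence which is geometrically equivalent to log-convex sequences satisfies an estimate
of Faà di Bruno type. -/
theorem seqLE_circ_of_logConvex {M N P : ℕ → ℝ} {D E : ℝ} (hM : ∀ k, 0 < M k)
    (hpos : ∀ k, 0 < N k) (hlc : ∀ k, N (k + 1) ^ 2 ≤ N k * N (k + 2)) (hD : 1 ≤ D) (hE : 0 < E)
    (hMN : ∀ k, M k ≤ D * N k) (hNP : ∀ k, N k ≤ E ^ k * P k) (hP0 : 1 ≤ P 0) :
    SeqLE (circ M) P := by
  set H := D * max 1 (N 1) with hH
  have hD0 : 0 < D := by linarith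
  have hH0 : 0 < H := by positivity
  refine ⟨D, hD0, H * E, by positivity, fun k => ?_⟩
  rw [circ]
  split_ifs with hk
  · subst hk
    simp only [pow_zero, mul_one]
    nlinarith
  refine Finset.sup'_le _ _ fun α _ => ?_
  have h1 : M α.length * ∏ i, M (α.blocksFun i) ≤
      (D * N α.length) * ∏ i, (D * N (α.blocksFun i)) := by
    refine mul_le_mul (hMN _) (Finset.prod_le_prod (fun i _ => (hM _).le) fun i _ => hMN _)
      (Finset.prod_nonneg fun i _ => (hM _).le) (mul_nonneg hD0.le (hpos _).le)
  have h2 := composition_length_mul_prod_le hpos hlc α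
  have hmax : (1 : ℝ) ≤ max 1 (N 1) := le_max_left _ _
  rw [Finset.prod_mul_distrib, Finset.prod_const, Finset.card_univ, Fintype.card_fin] at h1
  have hN := (hpos k).le
  have hN1 := (hpos 1).le
  calc M α.length * ∏ i, M (α.blocksFun i)
      ≤ D * N α.length * (D ^ α.length * ∏ i, N (α.blocksFun i)) := h1
    _ = D * D ^ α.length * (N α.length * ∏ i, N (α.blocksFun i)) := by ring
    _ ≤ D * D ^ α.length * (N 1 ^ α.length * N k) := by gcongr
    _ ≤ D * D ^ α.length * (max 1 (N 1) ^ α.length * N k) := by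
      gcongr
      exact le_max_right _ _
    _ = D * H ^ α.length * N k := by rw [hH, mul_pow]; ring
    _ ≤ D * H ^ k * N k := by
      gcongr
      · rw [hH]; nlinarith
      · exact α.length_le
    _ ≤ D * H ^ k * (E ^ k * P k) := by gcongr; exact hNP k
    _ = D * (H * E) ^ k * P k := by rw [mul_pow]; ring

/-- `(ω₇)` as a family of affine majorants of `ω`, one for each `u ≥ T`: monotonicity covers `s ≤
u`, and `(ω₇)` with `l = s/u` covers `s ≥ u`. -/
theorem IsPreWeight.exists_star_bound {ω : ℝ → ℝ} (hω : IsPreWeight ω) (h7 : Omega7 ω) :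
    ∃ C ≥ 1, ∃ T ≥ 1, (∀ u, T ≤ u → 0 < ω u) ∧
      ∀ u, T ≤ u → ∀ s, 0 ≤ s → ω s ≤ C * ω u * (1 + s / u) := by
  obtain ⟨C, hC, t₀, ht₀, h⟩ := h7
  obtain ⟨S, hS⟩ := eventually_atTop.1 (hω.tendsto.eventually_gt_atTop 0)
  refine ⟨max 1 C, le_max_left _ _, max 1 (max t₀ S), le_max_left _ _, ?_, ?_⟩
  · intro u hu
    exact hS u (((le_max_right _ _).trans (le_max_right _ _)).trans hu)
  intro u hu s hs
  have hu1 : 1 ≤ u := (le_max_left _ _).trans hu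
  have hut : t₀ ≤ u := ((le_max_left _ _).trans (le_max_right _ _)).trans hu
  have hu0 : 0 < u := by linarith
  have hωu := hω.nonneg u hu0.le
  have hC1 : (1 : ℝ) ≤ max 1 C := le_max_left _ _
  rcases le_total s u with hsu | hsu
  · have h1 : ω s ≤ ω u := hω.monotoneOn (mem_Ici.2 hs) (mem_Ici.2 hu0.le) hsu
    calc ω s ≤ 1 * ω u * (1 + 0) := by linarith
      _ ≤ max 1 C * ω u * (1 + s / u) := by gcongr; positivity
  · have h1 := h (s / u) (by rwa [one_le_div hu0]) u hut
    rw [div_mul_cancel₀ _ hu0.ne'] at h1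
    calc ω s ≤ C * (s / u) * ω u := h1
      _ = C * ω u * (0 + s / u) := by ring
      _ ≤ max 1 C * ω u * (1 + s / u) := by
        gcongr
        · exact le_max_right _ _
        · norm_num

theorem IsWeight.roumieuFdB {ω : ℝ → ℝ} (hω : IsWeight ω) (h7 : Omega7 ω) :
    RoumieuFdB (weightMatrix ω) := by
  rintro ⟨r, hr⟩
  rw [mem_Ioi] at hr
  obtain ⟨C, hC, T, hT, hpos, hstar⟩ := hω.toIsPreWeight.exists_star_bound h7
  have hC0 : 0 < C := by linarith
  have hρ : 0 < 2 * C * r := by positivity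
  -- `C` comes from the affine majorants; the `2` reflects that the majorant for `u` equals `2 C
  -- ω(u)` at `s = u`.
  refine ⟨⟨2 * C * r, hρ⟩, ?_⟩
  show SeqLE (circ (assocSeq ω r)) (assocSeq ω (2 * C * r))
  set ρ := 2 * C * r with hρr
  -- Chosen so that `b u * exp(-s / a u)` is `exp(-(C ω(u) / ρ)(1 + s/u))`, the exponential of an
  -- affine majorant. Its `k`-th moment supremum is comparable to `b u * (a u)^k * k!`, so dividing
  -- by `k!` leaves pure exponentials in `k`, whose supremum is log-convex.
  let a : Ici T → ℝ := fun u => ρ * u / (C * ω u)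
  let b : Ici T → ℝ := fun u => Real.exp (-(C * ω u / ρ))
  have hu0 : ∀ u : Ici T, 0 < (u : ℝ) := fun u => by have := u.2; rw [mem_Ici] at this; linarith
  have hωu : ∀ u : Ici T, 0 < ω u := fun u => hpos u u.2
  have ha : ∀ u, 0 < a u := fun u => by have := hu0 u; have := hωu u; positivity
  have hb : ∀ u, 0 < b u := fun u => Real.exp_pos _
  have lower : ∀ (k : ℕ) (u : Ici T), b u * a u ^ k ≤ Real.exp 1 ^ k * assocSeq ω ρ k := by
    intro k u
    have hau := ha u
    have hbu := hb u
    have key : (k * a u) ^ k * b u ≤ Real.exp 1 ^ k * momentSeq ω ρ k := by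
      -- Test at `s = k * a u`, where `s^k exp(-s / a u)` peaks. If this point lies below `1`, the
      -- left side is at most `1` and the claim is trivial.
      rcases le_total 1 (k * a u) with h | h
      · have h1 := hω.toIsPreWeight.pow_mul_exp_le_momentSeq hρ h k
        have h2 := hstar u u.2 (k * a u) (by positivity)
        have h3 : ω (k * a u) / ρ ≤ C * ω u / ρ + k := by
          rw [div_le_iff₀ hρ]
          have e : C * ω u * (1 + k * a u / u) = (C * ω u / ρ + k) * ρ := by
            have := (hωu u).ne'
            have := (hu0 u).ne'
            simp only [a]
            field_simp
          rwa [← e]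
        have h4 : b u ≤ Real.exp 1 ^ k * Real.exp (-(ω (k * a u) / ρ)) := by
          rw [← Real.exp_nat_mul, ← Real.exp_add, Real.exp_le_exp]
          linarith
        calc (k * a u) ^ k * b u
            ≤ (k * a u) ^ k * (Real.exp 1 ^ k * Real.exp (-(ω (k * a u) / ρ))) := by gcongr
          _ = Real.exp 1 ^ k * ((k * a u) ^ k * Real.exp (-(ω (k * a u) / ρ))) := by ring
          _ ≤ _ := by gcongr
      · have h1 : (k * a u) ^ k ≤ 1 := pow_le_one₀ (by positivity) h
        have h2 : b u ≤ 1 := by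
          rw [Real.exp_le_one_iff]
          have := (hωu u).le
          have : 0 ≤ C * ω u / ρ := by positivity
          linarith
        have h3 := hω.one_le_momentSeq hρ k
        have h4 : 1 ≤ Real.exp 1 ^ k := one_le_pow₀ (Real.one_le_exp zero_le_one)
        nlinarith
    rw [assocSeq_eq, ← mul_div_assoc, le_div_iff₀ (by positivity)]
    have hf : (k.factorial : ℝ) ≤ (k : ℝ) ^ k := by exact_mod_cast Nat.factorial_le_pow k
    calc b u * a u ^ k * k.factorial ≤ b u * a u ^ k * (k : ℝ) ^ k := by gcongr
      _ = (k * a u) ^ k * b u := by rw [mul_pow]; ring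
      _ ≤ _ := key
  have hbdd : ∀ k : ℕ, BddAbove (range fun i => b i * a i ^ k) := fun k =>
    ⟨_, by rintro _ ⟨u, rfl⟩; exact lower k u⟩
  have : Nonempty (Ici T) := ⟨⟨T, self_mem_Ici⟩⟩
  let N : ℕ → ℝ := fun k => ⨆ u, b u * a u ^ k
  have hNpos : ∀ k, 0 < N k := fun k =>
    lt_of_lt_of_le (by have := ha ⟨T, self_mem_Ici⟩; have := hb ⟨T, self_mem_Ici⟩; positivity)
      (le_ciSup (hbdd k) ⟨T, self_mem_Ici⟩)
  have hωT := (hpos T le_rfl).le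
  refine seqLE_circ_of_logConvex (N := N) (D := Real.exp (2 * C * ω T / ρ)) (E := Real.exp 1)
    (assocSeq_pos ω r) hNpos (iSup_mul_pow_logConvex ha hb hbdd)
    (Real.one_le_exp (by positivity)) (Real.exp_pos _) ?_ (fun k => ciSup_le (lower k)) ?_
  · intro k
    rw [assocSeq_eq, div_le_iff₀ (by positivity)]
    refine IsPreWeight.momentSeq_le hr k fun s hs => ?_
    have hs0 : 0 < s := by linarith
    -- Essentially `u = s`; the cutoff at `T`, where positivity of `ω` is known, is paid for by the
    -- constant `exp(2 C ω(T) / ρ)`.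
    let u : Ici T := ⟨max s T, mem_Ici.2 (le_max_right _ _)⟩
    have huv : (u : ℝ) = max s T := rfl
    have hau := ha u
    have hbu := hb u
    have h1 : ω u ≤ ω s + ω T := by
      have := hω.nonneg s hs0.le
      rcases le_total s T with h | h
      · rw [huv, max_eq_right h]; linarith
      · rw [huv, max_eq_left h]; linarith
    have h2 : s / u ≤ 1 := by
      rw [div_le_one (hu0 u)]
      exact le_max_left _ _
    have h3 : Real.exp (-(ω s / r)) ≤
        Real.exp (2 * C * ω T / ρ) * (b u * Real.exp (-(s / a u))) := by
      simp only [b]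
      rw [← Real.exp_add, ← Real.exp_add, Real.exp_le_exp]
      have e1 : ω s / r = 2 * C * ω s / ρ := by rw [hρr]; field_simp
      have e2 : s / a u = C * ω u * (s / u) / ρ := by
        have := (hωu u).ne'
        have := (hu0 u).ne'
        simp only [a]
        field_simp
      rw [e1, e2, ← sub_nonneg]
      have e3 : 2 * C * ω T / ρ + (-(C * ω u / ρ) + -(C * ω u * (s / u) / ρ)) -
          -(2 * C * ω s / ρ) = C * (2 * (ω T + ω s) - ω u * (1 + s / u)) / ρ := by ring
      rw [e3]
      have h5 : ω u * (1 + s / u) ≤ 2 * (ω T + ω s) := by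
        have := (hωu u).le
        nlinarith
      exact div_nonneg (mul_nonneg hC0.le (by linarith)) hρ.le
    have h4 : s ^ k * Real.exp (-(s / a u)) ≤ a u ^ k * k.factorial := by
      have := Real.pow_div_factorial_le_exp (s / a u) (by positivity) k
      rw [div_le_iff₀ (by positivity), div_pow, div_le_iff₀ (by positivity)] at this
      rw [Real.exp_neg, ← div_eq_mul_inv, div_le_iff₀ (Real.exp_pos _)]
      linarith
    calc s ^ k * Real.exp (-(ω s / r))
        ≤ s ^ k * (Real.exp (2 * C * ω T / ρ) * (b u * Real.exp (-(s / a u)))) := by gcongr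
      _ = Real.exp (2 * C * ω T / ρ) * b u * (s ^ k * Real.exp (-(s / a u))) := by ring
      _ ≤ Real.exp (2 * C * ω T / ρ) * b u * (a u ^ k * k.factorial) := by gcongr
      _ = Real.exp (2 * C * ω T / ρ) * (b u * a u ^ k) * k.factorial := by ring
      _ ≤ Real.exp (2 * C * ω T / ρ) * N k * k.factorial := by
        gcongr
        exact le_ciSup (hbdd k) u
  · rw [assocSeq_eq]
    simpa using hω.one_le_momentSeq hρ 0

/-! ### Faà di Bruno's formula and stability. -/

theorem sum_partSize {n : ℕ} (c : OrderedFinpartition n) : ∑ i, c.partSize i = n := by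
  have := Fintype.card_congr c.equivSigma
  simpa using this

/-- The total weight of an ordered partition in the Faà di Bruno formula for geometric series. -/
def partitionWeight (A : ℝ) {n : ℕ} (c : OrderedFinpartition n) : ℝ :=
  A ^ c.length * c.length.factorial * ∏ i, ((c.partSize i).factorial : ℝ)

theorem partitionWeight_nonneg {A : ℝ} (hA : 0 ≤ A) {n : ℕ} (c : OrderedFinpartition n) :
    0 ≤ partitionWeight A c := by
  rw [partitionWeight]; positivity

theorem partitionWeight_extendLeft (A : ℝ) {n : ℕ} (c : OrderedFinpartition n) :
    partitionWeight A c.extendLeft = A * (c.length + 1) * partitionWeight A c := by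
  have h : ∏ i, ((c.extendLeft.partSize i).factorial : ℝ) =
      ∏ i, ((c.partSize i).factorial : ℝ) := by
    change ∏ i : Fin (c.length + 1), ((Fin.cons (α := fun _ => ℕ) 1 c.partSize i).factorial : ℝ) = _
    rw [Fin.prod_univ_succ]
    simp
  rw [partitionWeight, h, partitionWeight]
  simp only [OrderedFinpartition.extendLeft_length, Nat.factorial_succ]
  push_cast
  ring

theorem partitionWeight_extendMiddle (A : ℝ) {n : ℕ} (c : OrderedFinpartition n)
    (k : Fin c.length) :
    partitionWeight A (c.extendMiddle k) = (c.partSize k + 1) * partitionWeight A c := by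
  have h : ∏ i, (((c.extendMiddle k).partSize i).factorial : ℝ) =
      (c.partSize k + 1) * ∏ i, ((c.partSize i).factorial : ℝ) := by
    change ∏ i : Fin c.length,
      ((Function.update c.partSize k (c.partSize k + 1) i).factorial : ℝ) = _
    rw [← Finset.mul_prod_erase _ _ (Finset.mem_univ k),
      ← Finset.mul_prod_erase (f := fun i => ((c.partSize i).factorial : ℝ)) _ (Finset.mem_univ k)]
    rw [Function.update_self, Nat.factorial_succ]
    push_cast
    rw [mul_assoc]
    congr 2
    refine Finset.prod_congr rfl fun i hi => ?_
    rw [Function.update_of_ne (Finset.ne_of_mem_erase hi)]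
  rw [partitionWeight, h, partitionWeight]
  simp only [OrderedFinpartition.extendMiddle_length]
  ring

/-- Add one point at a time. A new singleton multiplies the weight by `A (length + 1)`, joining part
`k` by `partSize k + 1`; the total factor `A (length + 1) + n + length` is at most `(n + 1)(A + 2)`.
-/
theorem sum_partitionWeight_le {A : ℝ} (hA : 0 ≤ A) (n : ℕ) :
    ∑ c : OrderedFinpartition n, partitionWeight A c ≤ n.factorial * (A + 2) ^ n := by
  induction n with
  | zero => simp [partitionWeight, default]
  | succ n ih =>
    rw [← (OrderedFinpartition.extendEquiv n).sum_comp, Fintype.sum_sigma]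
    have key : ∀ c : OrderedFinpartition n,
        ∑ o, partitionWeight A (OrderedFinpartition.extendEquiv n ⟨c, o⟩) ≤
          (n + 1) * (A + 2) * partitionWeight A c := by
      intro c
      have hlen : (c.length : ℝ) ≤ n := by exact_mod_cast c.length_le
      have hsum : ∑ i, (c.partSize i : ℝ) = n := by exact_mod_cast sum_partSize c
      have hw := partitionWeight_nonneg hA c
      rw [Fintype.sum_option]
      simp only [OrderedFinpartition.extendEquiv_apply, OrderedFinpartition.extend_none,
        OrderedFinpartition.extend_some, partitionWeight_extendLeft, partitionWeight_extendMiddle]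
      rw [← Finset.sum_mul, ← add_mul, Finset.sum_add_distrib, hsum]
      simp only [Finset.sum_const, Finset.card_univ, Fintype.card_fin, nsmul_eq_mul, mul_one]
      refine mul_le_mul_of_nonneg_right ?_ hw
      nlinarith
    calc _ ≤ ∑ c : OrderedFinpartition n, (n + 1) * (A + 2) * partitionWeight A c :=
          Finset.sum_le_sum fun c _ => key c
      _ = (n + 1) * (A + 2) * ∑ c : OrderedFinpartition n, partitionWeight A c := by
          rw [Finset.mul_sum]
      _ ≤ (n + 1) * (A + 2) * (n.factorial * (A + 2) ^ n) := by gcongr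
      _ = _ := by rw [Nat.factorial_succ]; push_cast; ring

theorem mul_prod_partSize_le_circ (M : ℕ → ℝ) (h0 : M 0 ≤ 1) {n : ℕ} (c : OrderedFinpartition n) :
    M c.length * ∏ i, M (c.partSize i) ≤ circ M n := by
  rw [circ]
  split_ifs with hn
  · subst hn
    have hl : c.length = 0 := Nat.le_zero.1 c.length_le
    have : IsEmpty (Fin c.length) := by rw [hl]; infer_instance
    simpa [hl] using h0
  let α : Composition n := ⟨List.ofFn c.partSize,
    fun {i} hi => by obtain ⟨j, rfl⟩ := List.mem_ofFn.1 hi; exact c.partSize_pos j,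
    by rw [List.sum_ofFn, sum_partSize]⟩
  have h := Finset.le_sup' (fun α : Composition n => M α.length * ∏ i, M (α.blocksFun i))
    (Finset.mem_univ α)
  refine le_trans (le_of_eq ?_) h
  have e1 : α.length = c.length := by simp [α, Composition.length]
  have e2 : ∏ i, M (α.blocksFun i) = (α.blocks.map M).prod := by
    rw [← α.ofFn_blocksFun, List.map_ofFn, List.prod_ofFn]
    rfl
  have e3 : (α.blocks.map M).prod = ∏ i, M (c.partSize i) := by
    rw [List.map_ofFn, List.prod_ofFn]
    rfl
  rw [e2, e3, e1]

theorem norm_iteratedFDeriv_comp_le_sum {E F G : Type*} [NormedAddCommGroup E] [NormedSpace ℝ E]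
    [NormedAddCommGroup F] [NormedSpace ℝ F] [NormedAddCommGroup G] [NormedSpace ℝ G]
    {U : Set E} {V : Set F} (hU : IsOpen U) (hV : IsOpen V) {g : E → F} {f : F → G}
    (hg : ContDiffOn ℝ (⊤ : ℕ∞) g U) (hf : ContDiffOn ℝ (⊤ : ℕ∞) f V) (hm : MapsTo g U V)
    {x : E} (hx : x ∈ U) (n : ℕ) :
    ‖iteratedFDeriv ℝ n (f ∘ g) x‖ ≤ ∑ c : OrderedFinpartition n,
      ‖iteratedFDeriv ℝ c.length f (g x)‖ * ∏ i, ‖iteratedFDeriv ℝ (c.partSize i) g x‖ := by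
  have hT := (hf.ftaylorSeriesWithin hV.uniqueDiffOn).comp
    (hg.ftaylorSeriesWithin hU.uniqueDiffOn) hm
  have e := hT.eq_iteratedFDerivWithin_of_uniqueDiffOn (m := n) (by exact_mod_cast le_top)
    hU.uniqueDiffOn hx
  rw [← iteratedFDerivWithin_of_isOpen n hU hx, ← e, FormalMultilinearSeries.taylorComp]
  refine (norm_sum_le _ _).trans (Finset.sum_le_sum fun c _ => ?_)
  refine (OrderedFinpartition.norm_compAlongOrderedFinpartition_le _ _ _).trans (le_of_eq ?_)
  simp only [ftaylorSeriesWithin]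
  rw [iteratedFDerivWithin_of_isOpen _ hV (hm hx)]
  congr 1
  exact Finset.prod_congr rfl fun i _ => by rw [iteratedFDerivWithin_of_isOpen _ hU hx]

theorem weightNorm_lt_top_iff {ω : ℝ → ℝ} {m n : ℕ} {K : Set (Euc m)} {ρ : ℝ}
    {f : Euc m → Euc n} :
    weightNorm ω K ρ f < ⊤ ↔
      ∃ C ≥ 0, ∀ x ∈ K, ∀ k : ℕ, ‖iteratedFDeriv ℝ k f x‖ ≤ C * momentSeq ω ρ k := by
  have key : ∀ (C : ℝ) (x : Euc m) (k : ℕ),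
      ‖iteratedFDeriv ℝ k f x‖ * Real.exp (-(1 / ρ * youngConj ω (ρ * k))) ≤ C ↔
        ‖iteratedFDeriv ℝ k f x‖ ≤ C * momentSeq ω ρ k := fun C x k => by
    rw [Real.exp_neg, ← div_eq_mul_inv, div_le_iff₀ (Real.exp_pos _), momentSeq]
  constructor
  · intro h
    refine ⟨(weightNorm ω K ρ f).toReal, ENNReal.toReal_nonneg, fun x hx k => ?_⟩
    rw [← key, ← ENNReal.ofReal_le_iff_le_toReal h.ne]
    exact le_iSup₂_of_le x hx (le_iSup (fun k : ℕ => ENNReal.ofReal (‖iteratedFDeriv ℝ k f x‖ *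
      Real.exp (-(1 / ρ * youngConj ω (ρ * k))))) k)
  · rintro ⟨C, -, h⟩
    refine lt_of_le_of_lt (b := ENNReal.ofReal C) ?_ ENNReal.ofReal_lt_top
    exact iSup₂_le fun x hx => iSup_le fun k =>
      ENNReal.ofReal_le_ofReal ((key C x k).2 (h x hx k))

theorem IsWeight.stableUnderComposition {ω : ℝ → ℝ} (hω : IsWeight ω)
    (h : RoumieuFdB (weightMatrix ω)) : StableUnderComposition (MemRoumieu ω) := by
  rintro p q r - - - U V W hU hV - g f ⟨hgm, hgs, hg⟩ ⟨hfm, hfs, hf⟩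
  refine ⟨hfm.comp hgm, hfs.comp hgs hgm, fun K hKU hK => ?_⟩
  obtain ⟨ρ₁, hρ₁, h₁⟩ := hg K hKU hK
  obtain ⟨ρ₂, hρ₂, h₂⟩ := hf (g '' K) (image_subset_iff.2 fun x hx => hgm (hKU hx))
    (hK.image_of_continuousOn (hgs.continuousOn.mono hKU))
  obtain ⟨A, hA, hA'⟩ := weightNorm_lt_top_iff.1 h₁
  obtain ⟨B, hB, hB'⟩ := weightNorm_lt_top_iff.1 h₂
  -- Moment sequences increase with the index, so one `ρ` serves both maps.
  set ρ := max ρ₁ ρ₂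
  have hρ : 0 < ρ := lt_max_of_lt_left hρ₁
  obtain ⟨⟨τ, hτ⟩, C, hC, b, hb, hM⟩ := h ⟨ρ, hρ⟩
  rw [mem_Ioi] at hτ
  replace hM : ∀ k, circ (assocSeq ω ρ) k ≤ C * b ^ k * assocSeq ω τ k := hM
  obtain ⟨τ', hτ', D, hD, hgeo⟩ := hω.toIsPreWeight.exists_pow_mul_momentSeq_le
    (h := (A + 2) * b) (by positivity) hτ
  refine ⟨τ', hτ', weightNorm_lt_top_iff.2 ⟨B * C * D, by positivity, fun x hx n => ?_⟩⟩
  have h0 : assocSeq ω ρ 0 ≤ 1 := by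
    rw [assocSeq_eq]
    simpa using hω.momentSeq_zero_le hρ
  have hfac : ∀ k, momentSeq ω ρ k = k.factorial * assocSeq ω ρ k := fun k => by
    rw [assocSeq_eq]; field_simp
  have hbound : ∀ c : OrderedFinpartition n,
      ‖iteratedFDeriv ℝ c.length f (g x)‖ * ∏ i, ‖iteratedFDeriv ℝ (c.partSize i) g x‖ ≤
        B * circ (assocSeq ω ρ) n * partitionWeight A c := by
    intro c
    have p1 : ‖iteratedFDeriv ℝ c.length f (g x)‖ ≤ B * momentSeq ω ρ c.length :=
      (hB' _ (mem_image_of_mem g hx) _).trans (mul_le_mul_of_nonneg_left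
        (hω.toIsPreWeight.momentSeq_mono hρ₂ (le_max_right _ _) _) hB)
    have p2 : ∀ i, ‖iteratedFDeriv ℝ (c.partSize i) g x‖ ≤ A * momentSeq ω ρ (c.partSize i) :=
      fun i => (hA' _ hx _).trans (mul_le_mul_of_nonneg_left
        (hω.toIsPreWeight.momentSeq_mono hρ₁ (le_max_left _ _) _) hA)
    have hw := partitionWeight_nonneg hA c
    calc _ ≤ (B * momentSeq ω ρ c.length) * ∏ i, (A * momentSeq ω ρ (c.partSize i)) := by
          refine mul_le_mul p1 (Finset.prod_le_prod (fun i _ => norm_nonneg _) fun i _ => p2 i)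
            (Finset.prod_nonneg fun i _ => norm_nonneg _)
            (mul_nonneg hB (momentSeq_pos _ _ _).le)
      _ = B * (assocSeq ω ρ c.length * ∏ i, assocSeq ω ρ (c.partSize i)) *
            partitionWeight A c := by
          simp only [hfac, partitionWeight, Finset.prod_mul_distrib, Finset.prod_const,
            Finset.card_univ, Fintype.card_fin]
          ring
      _ ≤ _ := by
          gcongr
          exact mul_prod_partSize_le_circ _ h0 c
  have hcirc : 0 ≤ circ (assocSeq ω ρ) n := by
    refine le_trans ?_ (mul_prod_partSize_le_circ _ h0 (OrderedFinpartition.atomic n))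
    exact mul_nonneg (assocSeq_pos _ _ _).le (Finset.prod_nonneg fun i _ => (assocSeq_pos _ _ _).le)
  calc ‖iteratedFDeriv ℝ n (f ∘ g) x‖
      ≤ ∑ c : OrderedFinpartition n, B * circ (assocSeq ω ρ) n * partitionWeight A c :=
        (norm_iteratedFDeriv_comp_le_sum hU hV hgs hfs hgm (hKU hx) n).trans
          (Finset.sum_le_sum fun c _ => hbound c)
    _ = B * circ (assocSeq ω ρ) n * ∑ c : OrderedFinpartition n, partitionWeight A c := by
        rw [Finset.mul_sum]
    _ ≤ B * (C * b ^ n * assocSeq ω τ n) * (n.factorial * (A + 2) ^ n) := by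
        refine mul_le_mul (mul_le_mul_of_nonneg_left (hM n) hB) (sum_partitionWeight_le hA n)
          (Finset.sum_nonneg fun c _ => partitionWeight_nonneg hA c) ?_
        have := (assocSeq_pos ω τ n).le
        positivity
    _ = B * C * (((A + 2) * b) ^ n * momentSeq ω τ n) := by
        rw [assocSeq_eq, mul_pow]
        field_simp
    _ ≤ B * C * (D * momentSeq ω τ' n) :=
        mul_le_mul_of_nonneg_left (hgeo n) (by positivity)
    _ = _ := by ring

/-! ### The extremal lacunary series. -/

/-- The `m`-th term of a lacunary trigonometric series. -/
def lacunaryTerm (ω : ℝ → ℝ) (m : ℕ) (x : ℝ) : ℂ :=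
  (((1 / 2 : ℝ) ^ m * Real.exp (-ω (2 ^ m)) : ℝ) : ℂ) *
    Complex.exp (((2 ^ m : ℝ) : ℂ) * Complex.I * x)

/-- A lacunary series lying in the class of `ω` whose derivatives at the origin are extremal. -/
def lacunarySeries (ω : ℝ → ℝ) (x : ℝ) : ℂ := ∑' m, lacunaryTerm ω m x

theorem contDiff_const_mul_cexp (a c : ℂ) :
    ContDiff ℝ (⊤ : ℕ∞) (fun x : ℝ => a * Complex.exp (c * x)) := by
  have : ContDiff ℝ (⊤ : ℕ∞) (fun x : ℝ => (x : ℂ)) := Complex.ofRealCLM.contDiff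
  fun_prop

theorem iteratedDeriv_const_mul_cexp (a c : ℂ) (k : ℕ) :
    iteratedDeriv k (fun x : ℝ => a * Complex.exp (c * x)) =
      fun x : ℝ => a * c ^ k * Complex.exp (c * x) := by
  induction k with
  | zero => simp
  | succ k ih =>
    rw [iteratedDeriv_succ, ih]
    funext x
    have h : HasDerivAt (fun x : ℝ => c * (x : ℂ)) c x := by
      simpa using (Complex.ofRealCLM.hasDerivAt (x := x)).const_mul c
    rw [(h.cexp.const_mul (a * c ^ k)).deriv]
    ring

theorem norm_iteratedDeriv_lacunaryTerm (ω : ℝ → ℝ) (k m : ℕ) (x : ℝ) :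
    ‖iteratedDeriv k (lacunaryTerm ω m) x‖ =
      (1 / 2) ^ m * (((2 : ℝ) ^ m) ^ k * Real.exp (-ω (2 ^ m))) := by
  have e : ‖Complex.exp (((2 ^ m : ℝ) : ℂ) * Complex.I * x)‖ = 1 := by
    have h : ((2 ^ m : ℝ) : ℂ) * Complex.I * x = ((2 ^ m * x : ℝ) : ℂ) * Complex.I := by
      push_cast
      ring
    rw [h, Complex.norm_exp_ofReal_mul_I]
  unfold lacunaryTerm
  rw [iteratedDeriv_const_mul_cexp]
  simp only [norm_mul, norm_pow, e, Complex.norm_real, Complex.norm_I, Real.norm_eq_abs,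
    Real.abs_exp]
  norm_num
  ring

theorem iteratedDeriv_lacunaryTerm_zero (ω : ℝ → ℝ) (k m : ℕ) :
    iteratedDeriv k (lacunaryTerm ω m) 0 =
      Complex.I ^ k * (((1 / 2) ^ m * Real.exp (-ω (2 ^ m)) * ((2 : ℝ) ^ m) ^ k : ℝ) : ℂ) := by
  unfold lacunaryTerm
  rw [iteratedDeriv_const_mul_cexp]
  simp only [Complex.ofReal_zero, mul_zero, Complex.exp_zero, mul_one]
  push_cast
  ring

theorem contDiff_lacunaryTerm (ω : ℝ → ℝ) (m : ℕ) :
    ContDiff ℝ (⊤ : ℕ∞) (lacunaryTerm ω m) := contDiff_const_mul_cexp _ _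

theorem summable_lacunary_majorant (ω : ℝ → ℝ) (k : ℕ) :
    Summable fun m : ℕ => (1 / 2 : ℝ) ^ m * momentSeq ω 1 k :=
  summable_geometric_two.mul_right _

namespace IsWeight

variable {ω : ℝ → ℝ}

theorem norm_iteratedDeriv_lacunaryTerm_le (hω : IsWeight ω) (k m : ℕ) (x : ℝ) :
    ‖iteratedDeriv k (lacunaryTerm ω m) x‖ ≤ (1 / 2) ^ m * momentSeq ω 1 k := by
  rw [norm_iteratedDeriv_lacunaryTerm]
  have := hω.toIsPreWeight.pow_mul_exp_le_momentSeq one_pos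
    (one_le_pow₀ one_le_two : (1 : ℝ) ≤ 2 ^ m) k
  rw [div_one] at this
  gcongr

theorem contDiff_lacunarySeries (hω : IsWeight ω) : ContDiff ℝ (⊤ : ℕ∞) (lacunarySeries ω) := by
  refine contDiff_tsum (contDiff_lacunaryTerm ω) (fun k _ => summable_lacunary_majorant ω k) ?_
  intro k m x _
  rw [norm_iteratedFDeriv_eq_norm_iteratedDeriv]
  exact hω.norm_iteratedDeriv_lacunaryTerm_le k m x

theorem hasSum_iteratedDeriv_lacunarySeries (hω : IsWeight ω) (k : ℕ) (x : ℝ) :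
    HasSum (fun m => iteratedDeriv k (lacunaryTerm ω m) x)
      (iteratedDeriv k (lacunarySeries ω) x) := by
  have hb : ∀ (k m : ℕ) (x : ℝ), (k : ℕ∞) ≤ ⊤ →
      ‖iteratedFDeriv ℝ k (lacunaryTerm ω m) x‖ ≤ (1 / 2) ^ m * momentSeq ω 1 k := by
    intro k m x _
    rw [norm_iteratedFDeriv_eq_norm_iteratedDeriv]
    exact hω.norm_iteratedDeriv_lacunaryTerm_le k m x
  have e := iteratedFDeriv_tsum_apply (N := ⊤) (contDiff_lacunaryTerm ω)
    (fun k _ => summable_lacunary_majorant ω k) hb (k := k) le_top x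
  have hs : Summable fun m => iteratedFDeriv ℝ k (lacunaryTerm ω m) x :=
    (summable_lacunary_majorant ω k).of_norm_bounded fun m => hb k m x le_top
  have hs' := hs.hasSum
  rw [← e] at hs'
  simp only [iteratedDeriv_eq_iteratedFDeriv]
  exact hs'.mapL (ContinuousMultilinearMap.apply ℝ (fun _ : Fin k => ℝ) ℂ fun _ => 1)

theorem norm_iteratedDeriv_lacunarySeries_le (hω : IsWeight ω) (k : ℕ) (x : ℝ) :
    ‖iteratedDeriv k (lacunarySeries ω) x‖ ≤ 2 * momentSeq ω 1 k := by
  rw [← (hω.hasSum_iteratedDeriv_lacunarySeries k x).tsum_eq]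
  exact tsum_of_norm_bounded (hasSum_geometric_two.mul_right _)
    fun m => hω.norm_iteratedDeriv_lacunaryTerm_le k m x

theorem norm_lacunarySeries_le (hω : IsWeight ω) (x : ℝ) : ‖lacunarySeries ω x‖ ≤ 2 := by
  have h1 := hω.norm_iteratedDeriv_lacunarySeries_le 0 x
  have h2 := hω.momentSeq_zero_le one_pos
  rw [iteratedDeriv_zero] at h1
  linarith

/-- At the origin all terms of the `k`-th derivative share the phase `i^k`, so there is no
cancellation and each single term is a lower bound. `γ 0 ≤ 2` later keeps `4 - γ 0` positive. -/
theorem exists_iteratedDeriv_lacunarySeries_zero (hω : IsWeight ω) :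
    ∃ γ : ℕ → ℝ, (∀ k, iteratedDeriv k (lacunarySeries ω) 0 = Complex.I ^ k * (γ k : ℂ)) ∧
      γ 0 ≤ 2 ∧ ∀ k m : ℕ, (1 / 2) ^ m * Real.exp (-ω (2 ^ m)) * ((2 : ℝ) ^ m) ^ k ≤ γ k := by
  have hs : ∀ k : ℕ, Summable fun m : ℕ =>
      (1 / 2 : ℝ) ^ m * Real.exp (-ω (2 ^ m)) * ((2 : ℝ) ^ m) ^ k := fun k => by
    refine (summable_lacunary_majorant ω k).of_nonneg_of_le (fun m => by positivity) fun m => ?_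
    have := hω.norm_iteratedDeriv_lacunaryTerm_le k m 0
    rw [norm_iteratedDeriv_lacunaryTerm] at this
    linarith
  have he : ∀ k, iteratedDeriv k (lacunarySeries ω) 0 = Complex.I ^ k *
      ((∑' m : ℕ, (1 / 2 : ℝ) ^ m * Real.exp (-ω (2 ^ m)) * ((2 : ℝ) ^ m) ^ k : ℝ) : ℂ) := by
    intro k
    have h1 := hω.hasSum_iteratedDeriv_lacunarySeries k 0
    simp only [iteratedDeriv_lacunaryTerm_zero] at h1
    exact h1.unique ((Complex.hasSum_ofReal.2 (hs k).hasSum).mul_left _)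
  refine ⟨_, he, ?_, fun k m => (hs k).le_tsum m fun i _ => by positivity⟩
  have h1 := hω.norm_lacunarySeries_le 0
  have h2 := he 0
  rw [iteratedDeriv_zero, pow_zero, one_mul] at h2
  rw [h2, Complex.norm_real] at h1
  exact (le_abs_self _).trans h1

end IsWeight

/-- Positivity of the derivatives of `1 / (4 - G)`, up to powers of `i`, and lower bounds for them,
expressed through the Leibniz recursion. -/
theorem exists_resolvent_lower_bound {H : ℕ → ℂ} {γ : ℕ → ℝ} (h0 : γ 0 < 4) (hγ : ∀ k, 0 ≤ γ k)
    (hrec : ∀ n, 4 * H n - (if n = 0 then 1 else 0) = ∑ i ∈ Finset.range (n + 1),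
      (n.choose i : ℂ) * (Complex.I ^ i * (γ i : ℂ)) * H (n - i)) {a b : ℝ}
    (ha : 0 ≤ a) (hb : 0 ≤ b) (hab : ∀ k, b * a ^ k ≤ γ k) (l n : ℕ) :
    b ^ l * (l * a) ^ n ≤ 4 ^ (l + 1) * ‖H n‖ := by
  -- Solving the recursion for `H n` divides by `4 - γ 0 > 0`, and the phases multiply to `i^n`;
  -- hence positivity propagates.
  have hreal : ∀ n, ∃ r : ℝ, 0 ≤ r ∧ H n = Complex.I ^ n * (r : ℂ) := by
    intro n
    induction n using Nat.strong_induction_on with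
    | _ n ih =>
      choose! r hr0 hr using ih
      have h := hrec n
      rw [Finset.sum_range_succ'] at h
      have e : ∑ i ∈ Finset.range n, (n.choose (i + 1) : ℂ) *
          (Complex.I ^ (i + 1) * (γ (i + 1) : ℂ)) * H (n - (i + 1)) =
          Complex.I ^ n * ((∑ i ∈ Finset.range n, (n.choose (i + 1) : ℝ) * γ (i + 1) *
            r (n - (i + 1)) : ℝ) : ℂ) := by
        rw [Complex.ofReal_sum, Finset.mul_sum]
        refine Finset.sum_congr rfl fun i hi => ?_
        have hi' := Finset.mem_range.1 hi
        rw [hr (n - (i + 1)) (by omega)]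
        have : Complex.I ^ n = Complex.I ^ (i + 1) * Complex.I ^ (n - (i + 1)) := by
          rw [← pow_add]; congr 1; omega
        rw [this]
        push_cast
        ring
      have e' : (if n = 0 then (1 : ℂ) else 0) =
          Complex.I ^ n * (((if n = 0 then 1 else 0 : ℝ)) : ℂ) := by
        split_ifs with hn
        · simp [hn]
        · simp
      rw [e, e'] at h
      set S := ∑ i ∈ Finset.range n, (n.choose (i + 1) : ℝ) * γ (i + 1) * r (n - (i + 1)) with hS
      have hS0 : 0 ≤ S := Finset.sum_nonneg fun i hi => by
        have := hr0 (n - (i + 1)) (by have := Finset.mem_range.1 hi; omega)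
        have := hγ (i + 1)
        positivity
      have h40 : (4 : ℂ) - γ 0 ≠ 0 := by
        have : (4 - γ 0 : ℝ) ≠ 0 := by linarith
        exact_mod_cast this
      refine ⟨((if n = 0 then 1 else 0) + S) / (4 - γ 0), ?_, ?_⟩
      · refine div_nonneg (add_nonneg ?_ hS0) (by linarith)
        split_ifs <;> norm_num
      · simp only [Nat.choose_zero_right, Nat.cast_one, pow_zero, one_mul, Nat.sub_zero] at h
        push_cast
        rw [mul_div_assoc', eq_div_iff h40]
        linear_combination h
  choose r hr0 hr using hreal
  have hnorm : ∀ n, ‖H n‖ = r n := fun n => by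
    rw [hr n, norm_mul, norm_pow, Complex.norm_I, one_pow, one_mul, Complex.norm_real,
      Real.norm_of_nonneg (hr0 n)]
  have hrec' : ∀ n, 4 * r n = (if n = 0 then 1 else 0) +
      ∑ i ∈ Finset.range (n + 1), (n.choose i : ℝ) * γ i * r (n - i) := by
    intro n
    have h := hrec n
    have e : ∑ i ∈ Finset.range (n + 1), (n.choose i : ℂ) *
        (Complex.I ^ i * (γ i : ℂ)) * H (n - i) =
        Complex.I ^ n * ((∑ i ∈ Finset.range (n + 1), (n.choose i : ℝ) * γ i *
          r (n - i) : ℝ) : ℂ) := by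
      rw [Complex.ofReal_sum, Finset.mul_sum]
      refine Finset.sum_congr rfl fun i hi => ?_
      have hi' := Finset.mem_range.1 hi
      rw [hr (n - i)]
      have : Complex.I ^ n = Complex.I ^ i * Complex.I ^ (n - i) := by
        rw [← pow_add]; congr 1; omega
      rw [this]
      push_cast
      ring
    have e' : (if n = 0 then (1 : ℂ) else 0) =
        Complex.I ^ n * (((if n = 0 then 1 else 0 : ℝ)) : ℂ) := by
      split_ifs with hn
      · simp [hn]
      · simp
    rw [e, e', hr n] at h
    have hI : Complex.I ^ n ≠ 0 := pow_ne_zero _ Complex.I_ne_zero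
    have h2 := mul_left_cancel₀ hI (a := Complex.I ^ n)
      (b := ((4 * r n - (if n = 0 then 1 else 0) : ℝ) : ℂ)) (c := _) (by
        rw [← h]; push_cast; ring)
    have h3 := Complex.ofReal_injective h2
    linarith
  rw [hnorm]
  have hδ : ∀ n : ℕ, (0 : ℝ) ≤ if n = 0 then 1 else 0 := fun n => by split_ifs <;> norm_num
  -- Step `l` isolates the Neumann term `G^l / 4^{l+1}`, and the binomial theorem turns `a` and `l
  -- a` into `(l + 1) a`. For `l = 0` the left side is `0^n`, so only `n = 0` has content.
  induction l generalizing n with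
  | zero =>
    have h := hrec' n
    rcases Nat.eq_zero_or_pos n with rfl | hn
    · simp only [if_true] at h
      have : 0 ≤ ∑ i ∈ Finset.range (0 + 1), ((0 : ℕ).choose i : ℝ) * γ i * r (0 - i) :=
        Finset.sum_nonneg fun i _ => by have := hr0 (0 - i); have := hγ i; positivity
      norm_num
      linarith
    · have := hr0 n
      simp only [Nat.cast_zero, zero_mul, zero_pow hn.ne', mul_zero]
      positivity
  | succ l ih =>
    have h := hrec' n
    have h1 : b * b ^ l * (a + l * a) ^ n ≤ ∑ i ∈ Finset.range (n + 1),
        4 ^ (l + 1) * ((n.choose i : ℝ) * γ i * r (n - i)) := by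
      rw [add_pow, Finset.mul_sum]
      refine Finset.sum_le_sum fun i _ => ?_
      have h2 := mul_le_mul (hab i) (ih (n - i)) (by positivity) (hγ i)
      have := mul_le_mul_of_nonneg_left h2 (Nat.cast_nonneg (α := ℝ) (n.choose i))
      calc _ = (n.choose i : ℝ) * (b * a ^ i * (b ^ l * (l * a) ^ (n - i))) := by ring
        _ ≤ _ := this
        _ = _ := by ring
    rw [← Finset.mul_sum] at h1
    have h2 := hδ n
    push_cast
    calc b ^ (l + 1) * ((l + 1) * a) ^ n = b * b ^ l * (a + l * a) ^ n := by ring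
      _ ≤ 4 ^ (l + 1) * ∑ i ∈ Finset.range (n + 1), ((n.choose i : ℝ) * γ i * r (n - i)) := h1
      _ ≤ 4 ^ (l + 1) * (4 * r n) := by gcongr; linarith
      _ = _ := by ring

/-! ### The resolvent and its composition with the series. -/

/-- The resolvent `z ↦ 1 / (4 - z)`. -/
def resolventAtFour (z : ℂ) : ℂ := (4 - z)⁻¹

theorem contDiffAt_resolventAtFour {𝕜 : Type*} [NontriviallyNormedField 𝕜] [NormedAlgebra 𝕜 ℂ]
    {n : WithTop ℕ∞} {z : ℂ} (hz : 4 - z ≠ 0) : ContDiffAt 𝕜 n resolventAtFour z :=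
  ContDiffAt.inv (contDiffAt_const.sub contDiffAt_id) hz

theorem norm_iteratedFDeriv_resolventAtFour {z : ℂ} (hz : 4 - z ≠ 0) (n : ℕ) :
    ‖iteratedFDeriv ℝ n resolventAtFour z‖ = n.factorial * ‖(4 - z)⁻¹‖ ^ (n + 1) := by
  rw [← (contDiffAt_resolventAtFour (𝕜 := ℂ) (n := n) hz).restrictScalars_iteratedFDeriv (𝕜 := ℝ),
    Function.comp_apply, ContinuousMultilinearMap.norm_restrictScalars,
    norm_iteratedFDeriv_eq_norm_iteratedDeriv, iteratedDeriv_eq_iterate]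
  have h := congrFun (iter_deriv_inv_linear (𝕜 := ℂ) n (-1) 4) z
  have e : resolventAtFour = fun x : ℂ => (-1 * x + 4)⁻¹ := by
    funext x
    rw [resolventAtFour]
    ring_nf
  rw [e, h]
  have e2 : (-1 * z + 4 : ℂ) = 4 - z := by ring
  have e3 : (-1 - n : ℤ) = -((n + 1 : ℕ) : ℤ) := by push_cast; ring
  rw [e2, e3, zpow_neg, zpow_natCast]
  simp

theorem sub_ne_zero_of_norm_lt_four {z : ℂ} (hz : ‖z‖ < 4) : 4 - z ≠ 0 := by
  intro h
  rw [sub_eq_zero] at h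
  rw [← h] at hz
  norm_num at hz

theorem resolvent_lacunarySeries_recursion {G : ℝ → ℂ} (hG : ContDiff ℝ (⊤ : ℕ∞) G)
    (h4 : ∀ x, ‖G x‖ < 4) (n : ℕ) :
    4 * iteratedDeriv n (resolventAtFour ∘ G) 0 - (if n = 0 then 1 else 0) =
      ∑ i ∈ Finset.range (n + 1), (n.choose i : ℂ) * iteratedDeriv i G 0 *
        iteratedDeriv (n - i) (resolventAtFour ∘ G) 0 := by
  have hh : ContDiff ℝ (⊤ : ℕ∞) (resolventAtFour ∘ G) := contDiff_iff_contDiffAt.2 fun x =>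
    (contDiffAt_resolventAtFour (sub_ne_zero_of_norm_lt_four (h4 x))).comp x hG.contDiffAt
  have hn : ((n : ℕ∞) : WithTop ℕ∞) ≤ ((⊤ : ℕ∞) : WithTop ℕ∞) := by exact_mod_cast le_top
  have hGn : ContDiffAt ℝ n G 0 := (hG.of_le hn).contDiffAt
  have hhn : ContDiffAt ℝ n (resolventAtFour ∘ G) 0 := (hh.of_le hn).contDiffAt
  rw [← iteratedDeriv_mul hGn hhn]
  -- The identity `G H = 4 H - 1` for `H = 1/(4 - G)`; Leibniz' rule applied to it is the recursion.
  have e : G * (resolventAtFour ∘ G) = fun x => 4 * (resolventAtFour ∘ G) x - 1 := by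
    funext x
    have := sub_ne_zero_of_norm_lt_four (h4 x)
    simp only [Pi.mul_apply, Function.comp_apply, resolventAtFour]
    field_simp
    ring
  rw [e, iteratedDeriv_fun_sub (contDiffAt_const.mul hhn) contDiffAt_const,
    iteratedDeriv_const_mul_field, iteratedDeriv_const]

section Isometries

/-- The isometry of the line with one-dimensional Euclidean space. -/
def realIso : ℝ ≃ₗᵢ[ℝ] Euc 1 := (OrthonormalBasis.singleton (Fin 1) ℝ).repr

/-- The isometry of the complex plane with two-dimensional Euclidean space. -/
def complexIso : ℂ ≃ₗᵢ[ℝ] Euc 2 := Complex.orthonormalBasisOneI.repr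

theorem norm_iteratedFDeriv_curve (G : ℝ → ℂ) (k : ℕ) (x : Euc 1) :
    ‖iteratedFDeriv ℝ k (complexIso ∘ G ∘ realIso.symm) x‖ =
      ‖iteratedDeriv k G (realIso.symm x)‖ := by
  rw [LinearIsometryEquiv.norm_iteratedFDeriv_comp_left,
    LinearIsometryEquiv.norm_iteratedFDeriv_comp_right, norm_iteratedFDeriv_eq_norm_iteratedDeriv]

theorem norm_iteratedFDeriv_planeMap (F : ℂ → ℂ) (k : ℕ) (x : Euc 2) :
    ‖iteratedFDeriv ℝ k (complexIso ∘ F ∘ complexIso.symm) x‖ =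
      ‖iteratedFDeriv ℝ k F (complexIso.symm x)‖ := by
  rw [LinearIsometryEquiv.norm_iteratedFDeriv_comp_left,
    LinearIsometryEquiv.norm_iteratedFDeriv_comp_right]

end Isometries

/-! ### Stability forces `(ω₇)`. -/

namespace IsWeight

variable {ω : ℝ → ℝ}

theorem memRoumieu_lacunarySeries (hω : IsWeight ω) :
    MemRoumieu ω 1 2 univ (Metric.ball 0 4) (complexIso ∘ lacunarySeries ω ∘ realIso.symm) := by
  refine ⟨fun x _ => ?_, ?_, fun K _ _ => ⟨1, one_pos, ?_⟩⟩
  · rw [mem_ball_zero_iff, Function.comp_apply, LinearIsometryEquiv.norm_map, Function.comp_apply]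
    linarith [hω.norm_lacunarySeries_le (realIso.symm x)]
  · exact (complexIso.contDiff.comp
      (hω.contDiff_lacunarySeries.comp realIso.symm.contDiff)).contDiffOn
  · refine weightNorm_lt_top_iff.2 ⟨2, by norm_num, fun x _ k => ?_⟩
    rw [norm_iteratedFDeriv_curve]
    exact hω.norm_iteratedDeriv_lacunarySeries_le k _

theorem memRoumieu_resolvent (hω : IsWeight ω) (h4 : Omega4 ω) :
    MemRoumieu ω 2 2 (Metric.ball 0 4) univ
      (complexIso ∘ resolventAtFour ∘ complexIso.symm) := by
  have hne : ∀ x ∈ Metric.ball (0 : Euc 2) 4, 4 - complexIso.symm x ≠ 0 := fun x hx =>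
    sub_ne_zero_of_norm_lt_four (by
      rw [LinearIsometryEquiv.norm_map]; exact mem_ball_zero_iff.1 hx)
  refine ⟨fun _ _ => mem_univ _, ?_, fun K hK hKc => ?_⟩
  · intro x hx
    exact (complexIso.contDiff.contDiffAt.comp x ((contDiffAt_resolventAtFour (hne x hx)).comp x
      complexIso.symm.contDiff.contDiffAt)).contDiffWithinAt
  · have hcont : ContinuousOn (fun x => (4 - complexIso.symm x)⁻¹) K :=
      (continuousOn_const.sub complexIso.symm.continuous.continuousOn).inv₀
        fun x hx => hne x (hK hx)
    obtain ⟨R, hR⟩ := hKc.exists_bound_of_continuousOn hcont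
    obtain ⟨τ, hτ, D, hD, hk⟩ := hω.exists_factorial_le h4 (h := max R 0) (by positivity)
    refine ⟨τ, hτ, weightNorm_lt_top_iff.2 ⟨max R 0 * D, by positivity, fun x hx k => ?_⟩⟩
    rw [norm_iteratedFDeriv_planeMap, norm_iteratedFDeriv_resolventAtFour (hne x (hK hx))]
    have h1 := (hR x hx).trans (le_max_left R 0)
    calc k.factorial * ‖(4 - complexIso.symm x)⁻¹‖ ^ (k + 1)
        ≤ k.factorial * max R 0 ^ (k + 1) := by gcongr
      _ = max R 0 * (max R 0 ^ k * k.factorial) := by ring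
      _ ≤ max R 0 * (D * momentSeq ω τ k) := by gcongr max R 0 * ?_; exact hk k
      _ = _ := by ring

theorem exists_dyadic_bound (hω : IsWeight ω) (h4 : Omega4 ω)
    (hstab : StableUnderComposition (MemRoumieu ω)) :
    ∃ τ > 0, ∃ C ≥ 1, ∀ l m : ℕ, 1 ≤ l →
      ω (l * 2 ^ m) / τ ≤ Real.log C + Real.log (l * 2 ^ m) + (l + 1) * Real.log 4 +
        l * (Real.log (2 ^ m) + ω (2 ^ m)) := by
  obtain ⟨-, -, hmem⟩ := hstab 1 2 2 one_pos two_pos two_pos _ _ _ isOpen_univ Metric.isOpen_ball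
    isOpen_univ _ _ hω.memRoumieu_lacunarySeries (hω.memRoumieu_resolvent h4)
  obtain ⟨τ, hτ, hfin⟩ := hmem {0} (subset_univ _) isCompact_singleton
  obtain ⟨C, hC, hb⟩ := weightNorm_lt_top_iff.1 hfin
  have ecomp : (complexIso ∘ resolventAtFour ∘ complexIso.symm) ∘
      (complexIso ∘ lacunarySeries ω ∘ realIso.symm) =
      complexIso ∘ (resolventAtFour ∘ lacunarySeries ω) ∘ realIso.symm := by
    funext x
    simp
  have hb' : ∀ n, ‖iteratedDeriv n (resolventAtFour ∘ lacunarySeries ω) 0‖ ≤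
      C * momentSeq ω τ n := fun n => by
    have := hb 0 rfl n
    rwa [ecomp, norm_iteratedFDeriv_curve, map_zero] at this
  obtain ⟨γ, hγ, hγ0, hγb⟩ := hω.exists_iteratedDeriv_lacunarySeries_zero
  have hrec := resolvent_lacunarySeries_recursion hω.contDiff_lacunarySeries
    (fun x => (hω.norm_lacunarySeries_le x).trans_lt (by norm_num))
  simp only [hγ] at hrec
  refine ⟨τ, hτ, max 1 C, le_max_left _ _, fun l m hl => ?_⟩
  have hC' : 0 < max 1 C := by positivity
  have hl1 : (1 : ℝ) ≤ l := by exact_mod_cast hl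
  have h2m : (1 : ℝ) ≤ 2 ^ m := one_le_pow₀ one_le_two
  set s : ℝ := l * 2 ^ m with hs
  have hs1 : 1 ≤ s := by rw [hs]; nlinarith
  have hs0 : 0 < s := by linarith
  set b : ℝ := (1 / 2) ^ m * Real.exp (-ω (2 ^ m)) with hbdef
  have hb0 : 0 < b := by positivity
  -- The lower bound for the `n`-th derivative carries exactly `s^n` with `s = l 2^m`; against
  -- `s^(n+1)` a single factor `s` survives, harmless after taking logarithms.
  obtain ⟨n, hn⟩ := hω.exists_momentSeq_mul_exp_le hτ hs1
  have hlow := exists_resolvent_lower_bound (by linarith)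
    (fun k => le_trans (by positivity) (hγb k 0)) hrec (a := 2 ^ m) (by positivity) hb0.le
    (fun k => hγb k m) l n
  rw [← hs] at hlow
  have hmain : b ^ l * Real.exp (ω s / τ) ≤ max 1 C * s * 4 ^ (l + 1) := by
    refine le_of_mul_le_mul_right ?_ (pow_pos hs0 n)
    calc b ^ l * Real.exp (ω s / τ) * s ^ n = b ^ l * s ^ n * Real.exp (ω s / τ) := by ring
      _ ≤ 4 ^ (l + 1) * (C * momentSeq ω τ n) * Real.exp (ω s / τ) := by
        refine mul_le_mul_of_nonneg_right ?_ (Real.exp_pos _).le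
        exact hlow.trans (mul_le_mul_of_nonneg_left (hb' n) (by positivity))
      _ = 4 ^ (l + 1) * C * (momentSeq ω τ n * Real.exp (ω s / τ)) := by ring
      _ ≤ 4 ^ (l + 1) * max 1 C * s ^ (n + 1) := by
        have h1 := le_max_right 1 C
        have h2 := (momentSeq_pos ω τ n).le
        gcongr
      _ = _ := by ring
  have hlog := Real.log_le_log (by positivity) hmain
  have hlogb : Real.log b = -Real.log (2 ^ m) - ω (2 ^ m) := by
    rw [hbdef, Real.log_mul (by positivity) (Real.exp_pos _).ne', Real.log_exp, one_div, inv_pow,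
      Real.log_inv]
    ring
  rw [Real.log_mul (pow_pos hb0 l).ne' (Real.exp_pos _).ne', Real.log_exp, Real.log_pow b l, hlogb,
    Real.log_mul (mul_pos hC' hs0).ne' (by positivity), Real.log_mul hC'.ne' hs0.ne',
    Real.log_pow 4 (l + 1)] at hlog
  push_cast at hlog
  linarith

theorem omega7_of_stable (hω : IsWeight ω) (h4 : Omega4 ω)
    (hstab : StableUnderComposition (MemRoumieu ω)) : Omega7 ω := by
  obtain ⟨τ, hτ, C, hC, hdy⟩ := hω.exists_dyadic_bound h4 hstab
  obtain ⟨L, hL, hdil⟩ := hω.toIsPreWeight.exists_dilation_bound (zero_le_two (α := ℝ))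
  obtain ⟨T, hT⟩ := eventually_atTop.1
    ((hω.omega2.def one_pos).and (hω.tendsto.eventually_ge_atTop 1))
  have hlogC : 0 ≤ Real.log C := Real.log_nonneg hC
  have hlog4 : 0 ≤ Real.log 4 := Real.log_nonneg (by norm_num)
  -- Each term of the dyadic bound is a multiple of `l ω(2^m)` once `ω(2^m) ≥ 1` and `log 2^m ≤
  -- ω(2^m)`. The `4` collects `log l`, `log 2^m` and the two parts of the last term.
  set B := τ * (Real.log C + 4 + 2 * Real.log 4) with hB
  have hB0 : 0 < B := by positivity
  have hnat : ∀ l m : ℕ, 1 ≤ l → T ≤ 2 ^ m → ω (l * 2 ^ m) ≤ B * l * ω (2 ^ m) := by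
    intro l m hl hm
    obtain ⟨h1, h2⟩ := hT _ hm
    have h2m : (1 : ℝ) ≤ 2 ^ m := one_le_pow₀ one_le_two
    have hl1 : (1 : ℝ) ≤ l := by exact_mod_cast hl
    rw [Real.norm_of_nonneg (Real.log_nonneg h2m), Real.norm_of_nonneg (by linarith),
      one_mul] at h1
    have h3 := hdy l m hl
    have h5 : Real.log l ≤ l := (Real.log_le_sub_one_of_pos (by linarith)).trans (by linarith)
    rw [Real.log_mul (by positivity) (by positivity), div_le_iff₀ hτ] at h3
    refine h3.trans ?_
    set w := ω (2 ^ m)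
    set q : ℝ := (l : ℝ)
    have hlw : 1 ≤ q * w := by nlinarith
    have hqw : q ≤ q * w := by nlinarith
    have hwq : w ≤ q * w := by nlinarith
    have k1 : Real.log C ≤ Real.log C * (q * w) := le_mul_of_one_le_right hlogC hlw
    have k2 : (q + 1) * Real.log 4 ≤ 2 * Real.log 4 * (q * w) := by nlinarith
    have k3 : q * (Real.log (2 ^ m) + w) ≤ 2 * (q * w) := by nlinarith
    have : Real.log C + (Real.log q + Real.log (2 ^ m)) + (q + 1) * Real.log 4 +
        q * (Real.log (2 ^ m) + w) ≤ (Real.log C + 4 + 2 * Real.log 4) * (q * w) := by linarith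
    calc _ ≤ (Real.log C + 4 + 2 * Real.log 4) * (q * w) * τ :=
          mul_le_mul_of_nonneg_right this hτ.le
      _ = _ := by rw [hB]; ring
  -- Rounding `r` up to an integer costs `2`; rounding `t` up to a power of two costs `2 L`, since
  -- `ω(2t) ≤ L ω(t) + L` and `ω(t) ≥ 1`.
  refine ⟨4 * B * L, by positivity, max T 1, by positivity, fun r hr t ht => ?_⟩
  have ht1 : 1 ≤ t := (le_max_right _ _).trans ht
  have htT : T ≤ t := (le_max_left _ _).trans ht
  have ht0 : 0 ≤ t := by linarith
  obtain ⟨n, hn, hn'⟩ := exists_nat_pow_near ht1 one_lt_two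
  have hn2 : (2 : ℝ) ^ (n + 1) ≤ 2 * t := by rw [pow_succ]; linarith
  have hceil : (⌈r⌉₊ : ℝ) ≤ 2 * r := by linarith [Nat.ceil_lt_add_one (by linarith : 0 ≤ r)]
  have h1 : ω (r * t) ≤ ω (⌈r⌉₊ * 2 ^ (n + 1)) := by
    refine hω.monotoneOn (mem_Ici.2 (by positivity)) (mem_Ici.2 (by positivity)) ?_
    exact mul_le_mul (Nat.le_ceil r) hn'.le ht0 (by positivity)
  have h2 := hnat ⌈r⌉₊ (n + 1) (Nat.one_le_ceil_iff.2 (by linarith)) (htT.trans hn'.le)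
  have h3 : ω (2 ^ (n + 1)) ≤ 2 * L * ω t := by
    have := hω.monotoneOn (mem_Ici.2 (by positivity)) (mem_Ici.2 (by positivity)) hn2
    have h5 := hdil t ht0
    have h6 := (hT t htT).2
    nlinarith
  have h7 := hω.nonneg (2 ^ (n + 1)) (by positivity)
  calc ω (r * t) ≤ B * ⌈r⌉₊ * ω (2 ^ (n + 1)) := h1.trans h2
    _ ≤ B * (2 * r) * (2 * L * ω t) := by gcongr
    _ = _ := by ring

end IsWeight

end Ultradiff

end

theorem theorem6p3 (ω : ℝ → ℝ) (hω : Ultradiff.IsWeight ω) (h4 : Ultradiff.Omega4 ω) :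
    List.TFAE
      [Ultradiff.StableUnderComposition (Ultradiff.MemRoumieu ω),
       Ultradiff.RoumieuFdB (Ultradiff.weightMatrix ω),
       ∃ σ : ℝ → ℝ, Ultradiff.IsPreWeight σ ∧ Ultradiff.IsSubadditive σ ∧
         Ultradiff.WeightEquiv ω σ,
       Ultradiff.Omega7 ω] := by
  tfae_have 1 → 4 := hω.omega7_of_stable h4
  tfae_have 4 → 2 := hω.roumieuFdB
  tfae_have 2 → 1 := hω.stableUnderComposition
  tfae_have 4 → 3 := fun h7 => ⟨Ultradiff.starHull ω, hω.starHull_isPreWeight h4,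
    hω.starHull_subadditive h4, hω.starHull_equiv h4 h7⟩
  tfae_have 3 → 4 := fun ⟨_, hσ, hs, he⟩ =>
    Ultradiff.Omega7.of_subadditive hω.toIsPreWeight hσ hs he
  tfae_finish
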